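/- Let $N\ge 3$, $\bar\mu=\left(\frac{N-2}{2}\right)^2$, $0<\mu<\bar\mu$, $\nu=\sqrt{\bar\mu}-\sqrt{\bar\mu-\mu}$ and $\alpha=N-2-2\nu$. Let $\Omega\subseteq\mathbb R^N$ be an open set, bounded or unbounded, with $0\in\Omega$ (for instance a smooth domain), let $q=\frac{2+\nu}{\nu}$ and $\frac{N+2}{N-2}\le p<q$. Let $u\in H^1_0(\Omega)\cap L^{q+1}(\Omega)$ be a radial weak solution of $$-\Delta u-\mu\frac{u}{|x|^2}=u^p-u^q\ \text{ in }\Omega,\qquad u>0\ \text{ in }\Omega,$$ where radial means that $u$ coincides almost everywhere in $\Omega$ with a function of $|x|$. Then $u$ agrees almost everywhere in $\Omega$ with a function that is continuous in a punctured neighbourhood of $0$, and for this representative $$\lim_{x\to 0}\frac{u(x)}{|x|^{-\nu}\,\bigl|\log|x|\bigr|^{-\nu/2}}=\left(\frac{\alpha\nu}{2}\right)^{\nu/2}.$$ -/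

import Mathlib

open MeasureTheory Filter Topology TopologicalSpace
open scoped Distributions

namespace HardyEq

/-- Euclidean space `ℝ^N`. -/
abbrev Euc (N : ℕ) : Type := EuclideanSpace ℝ (Fin N)

/-- The Hardy constant `((N - 2) / 2) ^ 2`. -/
noncomputable def muBar (N : ℕ) : ℝ := (((N : ℝ) - 2) / 2) ^ 2

/-- The exponent `ν = √μ̄ - √(μ̄ - μ)`. -/
noncomputable def nu (N : ℕ) (μ : ℝ) : ℝ :=
  Real.sqrt (muBar N) - Real.sqrt (muBar N - μ)

/-- The constant `α = N - 2 - 2ν`. -/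
noncomputable def alpha (N : ℕ) (μ : ℝ) : ℝ := (N : ℝ) - 2 - 2 * nu N μ

variable {N : ℕ}

/-- `G` is the weak gradient of `u` in the open set `Ω`. -/
structure IsWeakGradient (Ω : Opens (Euc N)) (u : Euc N → ℝ) (G : Euc N → Euc N) : Prop where
  locInt : LocallyIntegrableOn u (Ω : Set (Euc N))
  locInt_grad : LocallyIntegrableOn G (Ω : Set (Euc N))
  integral_eq : ∀ φ : 𝓓(Ω, ℝ),
    ∫ x in (Ω : Set (Euc N)), u x • gradient (φ : Euc N → ℝ) x =
      -∫ x in (Ω : Set (Euc N)), φ x • G x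

/-- `u` belongs to `H¹(Ω)`, with weak gradient `G`. -/
structure MemH1 (Ω : Opens (Euc N)) (u : Euc N → ℝ) (G : Euc N → Euc N) : Prop where
  weakGradient : IsWeakGradient Ω u G
  memLp : MemLp u 2 (volume.restrict (Ω : Set (Euc N)))
  memLp_grad : MemLp G 2 (volume.restrict (Ω : Set (Euc N)))

/-- `u` belongs to `H¹₀(Ω)`, the closure of `C_c^∞(Ω)` in `H¹(Ω)`, and `G` is its weak
gradient. -/
structure MemH10 (Ω : Opens (Euc N)) (u : Euc N → ℝ) (G : Euc N → Euc N) : Prop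
    extends MemH1 Ω u G where
  approx : ∃ φ : ℕ → 𝓓(Ω, ℝ),
    Tendsto (fun n => eLpNorm (fun x => φ n x - u x) 2 (volume.restrict (Ω : Set (Euc N))))
      atTop (𝓝 0) ∧
    Tendsto (fun n => eLpNorm (fun x => gradient (φ n : Euc N → ℝ) x - G x) 2
      (volume.restrict (Ω : Set (Euc N)))) atTop (𝓝 0)

/-- `u` is a weak solution of `-Δu - μ u / |x|² = u^p - u^q` in `Ω`, `u > 0` in `Ω`,
`u ∈ H¹₀(Ω) ∩ L^{q+1}(Ω)`. For such `u` every integrand below is integrable: the second one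
by Hardy's inequality (if `N ≥ 3`), the last one because `u ∈ L^{q+1}(Ω)` (if `1 ≤ p ≤ q`). -/
def IsSolution (Ω : Opens (Euc N)) (μ p q : ℝ) (u : Euc N → ℝ) : Prop :=
  (∀ᵐ x ∂volume.restrict (Ω : Set (Euc N)), 0 < u x) ∧
  MemLp u (ENNReal.ofReal (q + 1)) (volume.restrict (Ω : Set (Euc N))) ∧
  ∃ G : Euc N → Euc N, MemH10 Ω u G ∧
    ∀ φ : 𝓓(Ω, ℝ),
      (∫ x in (Ω : Set (Euc N)), inner ℝ (G x) (gradient (φ : Euc N → ℝ) x)) -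
          μ * ∫ x in (Ω : Set (Euc N)), u x * φ x / ‖x‖ ^ 2 =
        ∫ x in (Ω : Set (Euc N)), (u x ^ p - u x ^ q) * φ x

/-- `u` is (almost everywhere) a function of `|x|` alone in `Ω`. -/
def IsRadial (Ω : Opens (Euc N)) (u : Euc N → ℝ) : Prop :=
  ∃ f : ℝ → ℝ, ∀ᵐ x ∂volume.restrict (Ω : Set (Euc N)), u x = f ‖x‖

end HardyEq

/-! The Emden–Fowler substitution `u = |x| ^ (-ν) * w s`, `s = |x| ^ (-α)`, removes both the first
order term and the Hardy potential, because `ν` is a root of `ν ^ 2 - (N - 2) ν + μ = 0` and `α = N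
- 2 - 2ν`. As `ν q = 2 + ν`, what remains near `s = ∞` is `w'' = α ^ (-2) s ^ (-2) (w ^ q - s ^ (-κ)
w ^ p)` with `κ = ν (q - p) / α > 0`, and `u ∈ L ^ (q + 1)` becomes integrability of `w ^ (q + 1) /
s ^ 2`.

The reduction is done weakly (`integral_profile_mul_deriv_deriv`): the equation is tested against
`|x| ^ (-ν) χ (|x| ^ (-α))`, with `χ` a test function of `s`, and a one-dimensional Weyl lemma turns
the resulting distributional ODE into a classical one.

For the ODE, convexity up to a small correction together with the integrability forces `w → 0`
(`IsEmdenSolution.tendsto_zero`). Then `w` is compared with `c (log s + B) ^ (-m)`, `m = 1 / (q - 1)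
= ν / 2`: to leading order these solve `Y'' = k Y ^ q / s ^ 2` exactly when `k c ^ (q - 1) = m`. The
lower barrier needs no control of the `w ^ p` term, which has the favourable sign. It also shows
that `w` decays more slowly than any power, so `s ^ (-κ) w ^ p` is at most `ε w ^ q` eventually, and
an upper barrier with a constant tending to `c` as `ε → 0` follows. Since `log s = -α log |x|`,
going back to `x` divides `c = (α ^ 2 ν / 2) ^ (ν / 2)` by `α ^ (ν / 2)`. -/

namespace HardyEq

open Set
open scoped ContDiff

/-! ### Test functions on a half-line. -/

/-- Smooth functions on the line with compact support in `(a, ∞)`. -/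
structure IsTest (a : ℝ) (ψ : ℝ → ℝ) : Prop where
  smooth : ContDiff ℝ ∞ ψ
  compact : HasCompactSupport ψ
  supp : tsupport ψ ⊆ Ioi a

namespace IsTest

variable {a : ℝ} {ψ η : ℝ → ℝ}

/-- One interval holds both the support and the base point of the primitives, so that boundary terms
vanish in integrations by parts. -/
theorem exists_Icc (hψ : IsTest a ψ) {x₀ : ℝ} (hx₀ : a < x₀) :
    ∃ b c, a < b ∧ b < x₀ ∧ x₀ < c ∧ ∀ x, x ∉ Ioo b c → ψ x = 0 := by
  obtain ⟨K, hK, hs⟩ : ∃ b c, a < b ∧ tsupport ψ ⊆ Icc b c := by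
    rcases (tsupport ψ).eq_empty_or_nonempty with h | h
    · exact ⟨a + 1, a, by linarith, by simp [h]⟩
    · have hc : IsCompact (tsupport ψ) := hψ.compact
      exact ⟨sInf (tsupport ψ), sSup (tsupport ψ), hψ.supp (hc.sInf_mem h),
        fun x hx => ⟨csInf_le hc.bddBelow hx, le_csSup hc.bddAbove hx⟩⟩
  refine ⟨(a + min K x₀) / 2, max hK x₀ + 1, ?_, ?_, ?_, fun x hx => ?_⟩
  · have := lt_min hs.1 hx₀; linarith
  · have := lt_min hs.1 hx₀; have := min_le_right K x₀; linarith
  · have := le_max_right hK x₀; linarith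
  · refine image_eq_zero_of_notMem_tsupport fun h => hx ?_
    have h1 := hs.2 h
    have := lt_min hs.1 hx₀
    have := min_le_left K x₀
    have := le_max_left hK x₀
    exact ⟨by linarith [h1.1], by linarith [h1.2]⟩

theorem of_Icc (hs : ContDiff ℝ ∞ ψ) {b c : ℝ} (hb : a < b) (h : ∀ x, x ∉ Icc b c → ψ x = 0) :
    IsTest a ψ := by
  have hsub : tsupport ψ ⊆ Icc b c := by
    refine closure_minimal (fun x hx => ?_) isClosed_Icc
    by_contra hxs
    exact hx (h x hxs)
  exact ⟨hs, HasCompactSupport.intro isCompact_Icc h, fun x hx => lt_of_lt_of_le hb (hsub hx).1⟩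

theorem deriv (hψ : IsTest a ψ) : IsTest a (deriv ψ) := by
  refine ⟨?_, hψ.compact.deriv, (tsupport_deriv_subset).trans hψ.supp⟩
  exact (contDiff_infty_iff_deriv.1 hψ.smooth).2

theorem sub (hψ : IsTest a ψ) (hη : IsTest a η) : IsTest a (fun x => ψ x - η x) := by
  refine ⟨hψ.smooth.sub hη.smooth, hψ.compact.sub hη.compact, ?_⟩
  exact (tsupport_sub ψ η).trans (union_subset hψ.supp hη.supp)

theorem const_mul (hψ : IsTest a ψ) (k : ℝ) : IsTest a (fun x => k * ψ x) := by
  refine ⟨contDiff_const.mul hψ.smooth, hψ.compact.mul_left, ?_⟩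
  exact (closure_mono (Function.support_mul_subset_right _ _)).trans hψ.supp

theorem integrable_mul (hψ : IsTest a ψ) {w : ℝ → ℝ} (hw : LocallyIntegrableOn w (Ioi a)) :
    Integrable (fun x => w x * ψ x) := by
  obtain ⟨b, c, hb, -, -, h⟩ := hψ.exists_Icc (lt_add_one a)
  have h1 : IntegrableOn w (Icc b c) :=
    hw.integrableOn_compact_subset (fun x hx => lt_of_lt_of_le hb hx.1) isCompact_Icc
  have h2 : IntegrableOn (fun x => w x * ψ x) (Icc b c) :=
    h1.mul_continuousOn hψ.smooth.continuous.continuousOn isCompact_Icc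
  refine (integrableOn_iff_integrable_of_support_subset fun x hx => ?_).1 h2
  by_contra hx'
  exact hx (by simp [h x (fun h => hx' (Ioo_subset_Icc_self h))])

theorem integrable (hψ : IsTest a ψ) : Integrable ψ :=
  hψ.smooth.continuous.integrable_of_hasCompactSupport hψ.compact

theorem exists_integral_eq_one (a : ℝ) : ∃ ρ, IsTest a ρ ∧ ∫ x, ρ x = 1 := by
  let B : ContDiffBump (a + 2) := ⟨1 / 2, 1, by norm_num, by norm_num⟩
  refine ⟨B.normed volume, ⟨B.contDiff_normed, B.hasCompactSupport_normed, ?_⟩, B.integral_normed⟩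
  rw [B.tsupport_normed_eq, Real.closedBall_eq_Icc]
  intro x hx
  have := hx.1
  simp only [mem_Ioi]
  have h1 : B.rOut = 1 := rfl
  linarith

/-- Vanishing total mass is what makes the primitive from the left end return to zero to the right
of the support. -/
theorem exists_primitive (hψ : IsTest a ψ) (h0 : ∫ x, ψ x = 0) :
    ∃ η, IsTest a η ∧ _root_.deriv η = ψ := by
  obtain ⟨b, c, hb, hb', hc', h⟩ := hψ.exists_Icc (lt_add_one a)
  have hcont := hψ.smooth.continuous
  have hd : ∀ x, HasDerivAt (fun x => ∫ t in b..x, ψ t) (ψ x) x := fun x =>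
    intervalIntegral.integral_hasDerivAt_right (hcont.intervalIntegrable _ _)
      (hcont.stronglyMeasurableAtFilter _ _) hcont.continuousAt
  have hder : _root_.deriv (fun x => ∫ t in b..x, ψ t) = ψ := funext fun x => (hd x).deriv
  refine ⟨fun x => ∫ t in b..x, ψ t, of_Icc (b := b) (c := c) ?_ hb fun x hx => ?_, hder⟩
  · rw [contDiff_infty_iff_deriv, hder]
    exact ⟨fun x => (hd x).differentiableAt, hψ.smooth⟩
  · rcases lt_or_ge x b with hxb | hxb
    · refine intervalIntegral.integral_zero_ae (ae_of_all _ fun t ht => h t fun ht' => ?_)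
      rw [uIoc_of_ge hxb.le] at ht
      exact absurd ht'.1 (not_lt.2 ht.2)
    · have hxc : c < x := by
        by_contra hcx
        exact hx ⟨hxb, not_lt.1 hcx⟩
      change ∫ t in b..x, ψ t = 0
      rw [intervalIntegral.integral_eq_integral_of_support_subset, h0]
      intro t ht
      by_contra ht'
      exact ht (h t fun hh => ht' ⟨hh.1, (hh.2.trans hxc).le⟩)

end IsTest

/-! ### Distributional primitives and the one-dimensional Weyl lemma. -/

variable {a x₀ : ℝ} {w h k g : ℝ → ℝ}

theorem intervalIntegrable_of_locallyIntegrableOn_Ioi (hh : LocallyIntegrableOn h (Ioi a)) {b c : ℝ}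
    (hb : a < b) (hc : a < c) : IntervalIntegrable h volume b c := by
  rw [intervalIntegrable_iff]
  refine (hh.integrableOn_compact_subset (fun x hx => ?_) isCompact_uIcc).mono_set
    uIoc_subset_uIcc
  exact lt_of_lt_of_le (lt_min hb hc) hx.1

theorem continuousOn_primitive_Ioi (hh : LocallyIntegrableOn h (Ioi a)) (hx₀ : a < x₀) :
    ContinuousOn (fun x => ∫ t in x₀..x, h t) (Ioi a) := by
  intro x hx
  have hx' : a < x := hx
  obtain ⟨b, hab, hb⟩ := exists_between (lt_min hx' hx₀)
  have hbx := hb.trans_le (min_le_left _ _)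
  have hbx₀ := hb.trans_le (min_le_right _ _)
  set c := max x x₀ + 1
  have hc1 : x < c := by have := le_max_left x x₀; simp only [c]; linarith
  have hc2 : x₀ < c := by have := le_max_right x x₀; simp only [c]; linarith
  have hI : IntervalIntegrable h volume b c :=
    intervalIntegrable_of_locallyIntegrableOn_Ioi hh hab (hab.trans (hbx.trans hc1))
  have := intervalIntegral.continuousOn_primitive_interval' hI
    (a := x₀) (by rw [uIcc_of_le (hbx.trans hc1).le]; exact ⟨hbx₀.le, hc2.le⟩)
  rw [uIcc_of_le (hbx.trans hc1).le] at this
  exact (this.continuousAt (Icc_mem_nhds hbx hc1)).continuousWithinAt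

theorem locallyIntegrableOn_primitive (hh : LocallyIntegrableOn h (Ioi a)) (hx₀ : a < x₀) :
    LocallyIntegrableOn (fun x => ∫ t in x₀..x, h t) (Ioi a) :=
  (continuousOn_primitive_Ioi hh hx₀).locallyIntegrableOn measurableSet_Ioi

/-- Integration by parts against a test function. -/
theorem integral_primitive_mul_deriv (hh : LocallyIntegrableOn h (Ioi a)) (hx₀ : a < x₀)
    {ψ : ℝ → ℝ} (hψ : IsTest a ψ) :
    ∫ x, (∫ t in x₀..x, h t) * deriv ψ x = -∫ x, h x * ψ x := by
  obtain ⟨b, c, hb, hb', hc', hs⟩ := hψ.exists_Icc hx₀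
  have hbc : b < c := hb'.trans hc'
  have hI : IntervalIntegrable h volume b c :=
    intervalIntegrable_of_locallyIntegrableOn_Ioi hh hb (hb.trans hbc)
  have hmem : x₀ ∈ uIcc b c := by rw [uIcc_of_le hbc.le]; exact ⟨hb'.le, hc'.le⟩
  have hac := hI.absolutelyContinuousOnInterval_intervalIntegral hmem
  have hacψ : AbsolutelyContinuousOnInterval ψ b c :=
    (hψ.smooth.of_le (by simp)).contDiffOn.absolutelyContinuousOnInterval
  have key := hac.integral_mul_deriv_eq_deriv_mul hacψ
  rw [hs b (fun h => lt_irrefl _ h.1), hs c (fun h => lt_irrefl _ h.2)] at key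
  have hds : ∀ x, x ∉ Icc b c → deriv ψ x = 0 := by
    intro x hx
    refine image_eq_zero_of_notMem_tsupport fun hx' => hx ?_
    refine (closure_minimal ?_ isClosed_Icc : tsupport ψ ⊆ Icc b c) (tsupport_deriv_subset hx')
    intro y hy
    by_contra hy'
    exact hy (hs y fun h => hy' (Ioo_subset_Icc_self h))
  have e1 : ∫ x, (∫ t in x₀..x, h t) * deriv ψ x =
      ∫ x in b..c, (∫ t in x₀..x, h t) * deriv ψ x := by
    rw [intervalIntegral.integral_of_le hbc.le, ← integral_Icc_eq_integral_Ioc,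
      setIntegral_eq_integral_of_forall_compl_eq_zero]
    intro x hx
    simp [hds x hx]
  have e2 : ∫ x, h x * ψ x = ∫ x in b..c, h x * ψ x := by
    rw [intervalIntegral.integral_of_le hbc.le, ← integral_Icc_eq_integral_Ioc,
      setIntegral_eq_integral_of_forall_compl_eq_zero]
    intro x hx
    simp [hs x fun h => hx (Ioo_subset_Icc_self h)]
  have e3 : ∫ x in b..c, deriv (fun x => ∫ t in x₀..x, h t) x * ψ x = ∫ x in b..c, h x * ψ x := by
    refine intervalIntegral.integral_congr_ae ?_
    filter_upwards [hI.ae_hasDerivAt_integral] with x hx hx'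
    rw [(hx (uIoc_subset_uIcc hx') x₀ hmem).deriv]
  rw [e1, key, e3, e2]
  ring

/-- Du Bois-Reymond: for a fixed `ρ` of mass one, `η - (∫ η) ρ` is the derivative of a test
function, so `g` pairs with `η` as the constant `∫ g ρ` does. -/
theorem ae_eq_const_of_integral_mul_deriv (hg : LocallyIntegrableOn g (Ioi a))
    (H : ∀ ψ, IsTest a ψ → ∫ x, g x * deriv ψ x = 0) :
    ∃ c, ∀ᵐ x, x ∈ Ioi a → g x = c := by
  obtain ⟨ρ, hρ, hρ1⟩ := IsTest.exists_integral_eq_one a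
  refine ⟨∫ x, g x * ρ x, ?_⟩
  have hloc : LocallyIntegrableOn (fun x => g x - ∫ x, g x * ρ x) (Ioi a) :=
    hg.sub (locallyIntegrableOn_const _)
  have := isOpen_Ioi.ae_eq_zero_of_integral_contDiff_smul_eq_zero hloc ?_
  · filter_upwards [this] with x hx hxa
    exact sub_eq_zero.1 (hx hxa)
  · intro η h1 h2 h3
    have hη : IsTest a η := ⟨h1, h2, h3⟩
    have hθ := hη.sub (hρ.const_mul (∫ x, η x))
    obtain ⟨ψ, hψ, hψ'⟩ := hθ.exists_primitive (by
      rw [integral_sub hη.integrable (hρ.integrable.const_mul _), integral_const_mul, hρ1]; ring)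
    have := H ψ hψ
    rw [hψ'] at this
    have e : ∀ x, g x * (η x - (∫ x, η x) * ρ x) = g x * η x - (∫ x, η x) * (g x * ρ x) :=
      fun x => by ring
    simp only [e] at this
    rw [integral_sub (hη.integrable_mul hg) ((hρ.integrable_mul hg).const_mul _),
      integral_const_mul] at this
    have e' : ∀ x, η x • (g x - ∫ x, g x * ρ x) = g x * η x - (∫ x, g x * ρ x) * η x :=
      fun x => by simp only [smul_eq_mul]; ring
    simp only [e']
    rw [integral_sub (hη.integrable_mul hg) (hη.integrable.const_mul _), integral_const_mul]
    linarith

theorem ae_eq_primitive_of_integral_mul_deriv (hw : LocallyIntegrableOn w (Ioi a))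
    (hk : LocallyIntegrableOn k (Ioi a)) (hx₀ : a < x₀)
    (H : ∀ ψ, IsTest a ψ → ∫ x, w x * deriv ψ x = -∫ x, k x * ψ x) :
    ∃ c, ∀ᵐ x, x ∈ Ioi a → w x = c + ∫ t in x₀..x, k t := by
  have hK := locallyIntegrableOn_primitive hk hx₀
  obtain ⟨c, hc⟩ := ae_eq_const_of_integral_mul_deriv (hw.sub hK) (fun ψ hψ => by
    simp only [Pi.sub_apply, sub_mul]
    rw [integral_sub (hψ.deriv.integrable_mul hw) (hψ.deriv.integrable_mul hK), H ψ hψ,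
      integral_primitive_mul_deriv hk hx₀ hψ, sub_self])
  refine ⟨c, ?_⟩
  filter_upwards [hc] with x hx hxa
  have := hx hxa
  simp only [Pi.sub_apply] at this
  linarith

/-- One-dimensional Weyl lemma: a distributional solution of `w'' = h` is a double primitive. -/
theorem ae_eq_double_primitive (hw : LocallyIntegrableOn w (Ioi a))
    (hh : LocallyIntegrableOn h (Ioi a)) (hx₀ : a < x₀)
    (H : ∀ ψ, IsTest a ψ → ∫ x, w x * deriv (deriv ψ) x = ∫ x, h x * ψ x) :
    ∃ c₁ c₂, ∀ᵐ x, x ∈ Ioi a → w x = c₁ + ∫ t in x₀..x, (c₂ + ∫ s in x₀..t, h s) := by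
  obtain ⟨ρ, hρ, hρ1⟩ := IsTest.exists_integral_eq_one a
  have hP := locallyIntegrableOn_primitive hh hx₀
  set P : ℝ → ℝ := fun x => ∫ s in x₀..x, h s with hPdef
  -- The value is forced by requiring `∫ w ρ' = -∫ (c₂ + P) ρ` for the normalised `ρ`.
  set c₂ : ℝ := -((∫ x, w x * deriv ρ x) + ∫ x, P x * ρ x)
  have hk : LocallyIntegrableOn (fun x => c₂ + P x) (Ioi a) := (locallyIntegrableOn_const _).add hP
  obtain ⟨c₁, hc₁⟩ := ae_eq_primitive_of_integral_mul_deriv hw hk hx₀ (fun η hη => by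
    have hθ := hη.sub (hρ.const_mul (∫ x, η x))
    obtain ⟨ψ, hψ, hψ'⟩ := hθ.exists_primitive (by
      rw [integral_sub hη.integrable (hρ.integrable.const_mul _), integral_const_mul, hρ1]; ring)
    have h1 := H ψ hψ
    have h2 := integral_primitive_mul_deriv hh hx₀ hψ
    have hd : ∀ x, deriv (fun x => η x - (∫ x, η x) * ρ x) x =
        deriv η x - (∫ x, η x) * deriv ρ x := by
      intro x
      have d1 := (hη.smooth.differentiable (by simp)) x
      have d2 := (hρ.smooth.differentiable (by simp)) x
      exact (d1.hasDerivAt.sub (d2.hasDerivAt.const_mul _)).deriv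
    rw [hψ'] at h1 h2
    simp only [hd] at h1
    have e1 : ∀ x, w x * (deriv η x - (∫ x, η x) * deriv ρ x) =
        w x * deriv η x - (∫ x, η x) * (w x * deriv ρ x) := fun x => by ring
    have e2 : ∀ x, P x * (η x - (∫ x, η x) * ρ x) =
        P x * η x - (∫ x, η x) * (P x * ρ x) := fun x => by ring
    have e3 : ∀ x, (c₂ + P x) * η x = c₂ * η x + P x * η x := fun x => by ring
    change ∫ x, P x * (η x - (∫ x, η x) * ρ x) = _ at h2
    simp only [e1] at h1
    simp only [e2] at h2
    simp only [e3]
    rw [integral_sub (hη.deriv.integrable_mul hw) ((hρ.deriv.integrable_mul hw).const_mul _),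
      integral_const_mul] at h1
    rw [integral_sub (hη.integrable_mul hP) ((hρ.integrable_mul hP).const_mul _),
      integral_const_mul] at h2
    rw [integral_add (hη.integrable.const_mul _) (hη.integrable_mul hP), integral_const_mul]
    simp only [c₂]
    linear_combination h1 + h2)
  exact ⟨c₁, c₂, hc₁⟩

/-! ### Maximum principle and logarithmic barriers. -/

/-- Maximum principle on a half-line for functions vanishing at infinity. -/
theorem nonneg_of_neg_imp_deriv2_neg {b : ℝ} {z z₁ z₂ : ℝ → ℝ}
    (hz : ∀ s, b ≤ s → HasDerivAt z (z₁ s) s) (hz₁ : ∀ s, b ≤ s → HasDerivAt z₁ (z₂ s) s)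
    (hb : 0 ≤ z b) (hlim : Tendsto z atTop (𝓝 0)) (h : ∀ s, b ≤ s → z s < 0 → z₂ s < 0) :
    ∀ s, b ≤ s → 0 ≤ z s := by
  intro s hs
  by_contra! hneg
  obtain ⟨M, hM⟩ := eventually_atTop.1 (hlim.eventually (lt_mem_nhds hneg))
  have hcont : ContinuousOn z (Icc b (max M s)) :=
    fun x hx => (hz x hx.1).continuousAt.continuousWithinAt
  obtain ⟨t, ht, hmin⟩ := isCompact_Icc.exists_isMinOn ⟨s, hs, le_max_right M s⟩ hcont
  have hmin' : ∀ x, b ≤ x → z t ≤ z x := by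
    intro x hx
    rcases le_total x (max M s) with hx' | hx'
    · exact hmin ⟨hx, hx'⟩
    · exact (hmin ⟨hs, le_max_right M s⟩).trans (hM x ((le_max_left _ _).trans hx')).le
  have htneg : z t < 0 := (hmin' s hs).trans_lt hneg
  have hbt : b < t := lt_of_le_of_ne ht.1 fun hh => by rw [← hh] at htneg; linarith
  have hnhds : ∀ᶠ x in 𝓝 t, b ≤ x := (eventually_gt_nhds hbt).mono fun _ h => h.le
  have hlocmin : IsLocalMin z t := hnhds.mono fun x hx => hmin' x hx
  have hd : ∀ᶠ x in 𝓝 t, deriv z x = z₁ x := hnhds.mono fun x hx => (hz x hx).deriv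
  have hdd : deriv (deriv z) t = z₂ t := by
    rw [EventuallyEq.deriv_eq hd, (hz₁ t ht.1).deriv]
  -- The negative second derivative makes the minimum point a local maximum too. Then `z` is locally
  -- constant and its second derivative vanishes there.
  have hlocmax : IsLocalMax z t := by
    refine isLocalMax_of_deriv_deriv_neg (by rw [hdd]; exact h t ht.1 htneg)
      hlocmin.deriv_eq_zero (hz t ht.1).continuousAt
  have hconst : z =ᶠ[𝓝 t] fun _ => z t := by
    filter_upwards [hlocmin, hlocmax] with x h1 h2 using le_antisymm h2 h1
  have : deriv (deriv z) t = 0 := by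
    rw [EventuallyEq.deriv_eq hconst.deriv]
    simp
  linarith [h t ht.1 htneg]

section Barrier

variable (c B m : ℝ)

/-- The comparison function `c (log s + B) ^ (-m)`. -/
noncomputable def logBarrier (s : ℝ) : ℝ := c * (Real.log s + B) ^ (-m)

variable {c B m} {s : ℝ}

theorem hasDerivAt_logBarrier (hs : 0 < s) (hB : 0 < Real.log s + B) :
    HasDerivAt (logBarrier c B m) (-(m * c) * ((Real.log s + B) ^ (-m - 1) / s)) s := by
  have h1 : HasDerivAt (fun x => Real.log x + B) s⁻¹ s := (Real.hasDerivAt_log hs.ne').add_const B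
  have h2 := (h1.rpow_const (p := -m) (Or.inl hB.ne')).const_mul c
  refine h2.congr_deriv ?_
  field_simp

theorem hasDerivAt_deriv_logBarrier (hs : 0 < s) (hB : 0 < Real.log s + B) :
    HasDerivAt (fun s => -(m * c) * ((Real.log s + B) ^ (-m - 1) / s))
      (m * c * (Real.log s + B) ^ (-m - 1) * (1 + (m + 1) / (Real.log s + B)) / s ^ 2) s := by
  have h1 : HasDerivAt (fun x => Real.log x + B) s⁻¹ s := (Real.hasDerivAt_log hs.ne').add_const B
  have h2 := ((h1.rpow_const (p := -m - 1) (Or.inl hB.ne')).div (hasDerivAt_id s) hs.ne').const_mul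
    (-(m * c))
  refine h2.congr_deriv ?_
  rw [Real.rpow_sub_one hB.ne' (-m - 1)]
  simp only [id]
  field_simp
  ring

theorem tendsto_logBarrier (hm : 0 < m) : Tendsto (logBarrier c B m) atTop (𝓝 0) := by
  have h1 : Tendsto (fun s => Real.log s + B) atTop atTop :=
    tendsto_atTop_add_const_right _ _ Real.tendsto_log_atTop
  have := ((tendsto_rpow_neg_atTop hm).comp h1).const_mul c
  rwa [mul_zero] at this

/-- The shift `B` does not affect the leading order, so it is free to be used for matching boundary
values. -/
theorem tendsto_logBarrier_mul_log :
    Tendsto (fun s => logBarrier c B m s * Real.log s ^ m) atTop (𝓝 c) := by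
  have h1 : Tendsto (fun s => Real.log s + B) atTop atTop :=
    tendsto_atTop_add_const_right _ _ Real.tendsto_log_atTop
  have h2 : Tendsto (fun s => 1 - B / (Real.log s + B)) atTop (𝓝 (1 - 0)) :=
    tendsto_const_nhds.sub (tendsto_const_nhds.div_atTop h1)
  have h3 : Tendsto (fun s => c * (1 - B / (Real.log s + B)) ^ m) atTop (𝓝 (c * (1 - 0) ^ m)) :=
    (h2.rpow_const (Or.inl (by norm_num))).const_mul c
  simp only [sub_zero, Real.one_rpow, mul_one] at h3
  refine h3.congr' ?_
  filter_upwards [h1.eventually_gt_atTop 0, Real.tendsto_log_atTop.eventually_gt_atTop 0]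
    with s hs hs'
  have : 1 - B / (Real.log s + B) = Real.log s / (Real.log s + B) := by field_simp; ring
  rw [this, Real.div_rpow hs'.le hs.le, logBarrier, Real.rpow_neg hs.le]
  ring

end Barrier

/-! ### Asymptotics of the Emden–Fowler equation. -/

/-- Absorption of the lower order power. -/
theorem half_rpow_sub_le {p q r t : ℝ} (hp : 0 < p) (hpq : p < q) (hr : 0 ≤ r) (hr1 : r ≤ 1)
    (ht : 0 ≤ t) :
    t ^ q / 2 - (2 ^ (1 / (q - p))) ^ p * r ≤ t ^ q - r * t ^ p := by
  -- The threshold `C ^ (q - p) = 2`: above it `t ^ q` dominates `2 t ^ p`, below it `t ^ p` is at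
  -- most `C ^ p`.
  set C : ℝ := 2 ^ (1 / (q - p)) with hC
  have hqp : 0 < q - p := sub_pos.2 hpq
  have hCpos : 0 < C := by positivity
  rcases le_or_gt C t with h | h
  · have htpos : 0 < t := hCpos.trans_le h
    have h2 : 2 ≤ t ^ (q - p) := by
      calc (2 : ℝ) = C ^ (q - p) := by
            rw [hC, ← Real.rpow_mul (by norm_num), one_div_mul_cancel hqp.ne', Real.rpow_one]
        _ ≤ t ^ (q - p) := Real.rpow_le_rpow hCpos.le h hqp.le
    have h3 : t ^ q = t ^ (q - p) * t ^ p := by rw [← Real.rpow_add htpos]; ring_nf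
    have h4 : 0 ≤ t ^ p := by positivity
    have h5 : 0 ≤ C ^ p * r := by positivity
    have h6 : r * t ^ p ≤ t ^ p := mul_le_of_le_one_left h4 hr1
    have h7 : 2 * t ^ p ≤ t ^ q := by rw [h3]; exact mul_le_mul_of_nonneg_right h2 h4
    linarith
  · have h4 : t ^ p ≤ C ^ p := Real.rpow_le_rpow ht h.le hp.le
    have h5 : 0 ≤ t ^ q := by positivity
    have h6 := mul_le_mul_of_nonneg_left h4 hr
    linarith [mul_comm r (C ^ p)]

/-- Nonnegative solutions on `(a, ∞)` of `w'' = k s⁻² (w ^ q - s ^ (-κ) w ^ p)`, with `w'` the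
function `w₁`. -/
structure IsEmdenSolution (a k κ p q : ℝ) (w w₁ : ℝ → ℝ) : Prop where
  hasDerivAt : ∀ s, a < s → HasDerivAt w (w₁ s) s
  hasDerivAt_deriv : ∀ s, a < s → HasDerivAt w₁ (k * (w s ^ q - s ^ (-κ) * w s ^ p) / s ^ 2) s
  nonneg : ∀ s, a < s → 0 ≤ w s

namespace IsEmdenSolution

variable {a k κ p q : ℝ} {w w₁ : ℝ → ℝ}

/-- Adding `A s ^ (-κ)` makes `w` convex. A positive slope would give linear growth, against the
integrability, so the sum decreases to a limit. A positive limit would give a second derivative at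
least `c / s ^ 2`, hence a decrease at least like `c log s`, against nonnegativity. -/
theorem tendsto_zero (hw : IsEmdenSolution a k κ p q w w₁) (ha : 0 < a) (hk : 0 < k) (hκ : 0 < κ)
    (hp : 0 < p) (hpq : p < q) (hq : 1 < q)
    (hint : IntegrableOn (fun s => w s ^ (q + 1) / s ^ 2) (Ioi a)) :
    Tendsto w atTop (𝓝 0) := by
  set C : ℝ := (2 ^ (1 / (q - p))) ^ p
  have hC : 0 < C := by positivity
  -- With this `A`, the second derivative of `A s ^ (-κ)` is exactly the error `k C s ^ (-κ) / s ^
  -- 2` left by `half_rpow_sub_le`.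
  set A : ℝ := k * C / (κ * (κ + 1)) with hA
  have hApos : 0 < A := by positivity
  set b : ℝ := max a 1 + 1 with hb
  have hba : a < b := by have := le_max_left a 1; linarith
  have hb1 : 1 < b := by have := le_max_right a 1; linarith
  set z : ℝ → ℝ := fun s => w s + A * s ^ (-κ) with hzdef
  set z₁ : ℝ → ℝ := fun s => w₁ s + A * (-κ * s ^ (-κ - 1)) with hz₁def
  set z₂ : ℝ → ℝ := fun s => k * (w s ^ q - s ^ (-κ) * w s ^ p) / s ^ 2 +
    A * (-κ * ((-κ - 1) * s ^ (-κ - 1 - 1))) with hz₂def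
  have hz : ∀ s, b ≤ s → HasDerivAt z (z₁ s) s := fun s hs =>
    (hw.hasDerivAt s (by linarith)).add
      ((Real.hasDerivAt_rpow_const (Or.inl (by linarith))).const_mul A)
  have hz₁ : ∀ s, b ≤ s → HasDerivAt z₁ (z₂ s) s := fun s hs =>
    (hw.hasDerivAt_deriv s (by linarith)).add
      (((Real.hasDerivAt_rpow_const (Or.inl (by linarith))).const_mul (-κ)).const_mul A)
  have hz₂ : ∀ s, b ≤ s → k * w s ^ q / 2 / s ^ 2 ≤ z₂ s := by
    intro s hs
    have hs0 : 0 < s := by linarith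
    have hr : s ^ (-κ) ≤ 1 := Real.rpow_le_one_of_one_le_of_nonpos (by linarith) (by linarith)
    have h1 := half_rpow_sub_le hp hpq (Real.rpow_nonneg hs0.le (-κ)) hr
      (hw.nonneg s (by linarith))
    have h2 : A * (-κ * ((-κ - 1) * s ^ (-κ - 1 - 1))) = k * (C * s ^ (-κ)) / s ^ 2 := by
      rw [hA, Real.rpow_sub_one hs0.ne', Real.rpow_sub_one hs0.ne']
      field_simp
      ring
    simp only [hz₂def]
    rw [h2, ← add_div]
    refine div_le_div_of_nonneg_right ?_ (by positivity)
    have h3 := mul_le_mul_of_nonneg_left h1 hk.le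
    linarith
  have hmono : MonotoneOn z₁ (Ici b) := by
    refine monotoneOn_of_hasDerivWithinAt_nonneg (convex_Ici b)
      (fun s hs => (hz₁ s hs).continuousAt.continuousWithinAt)
      (f' := z₂) (fun s hs => (hz₁ s (interior_subset hs)).hasDerivWithinAt) fun s hs => ?_
    refine le_trans ?_ (hz₂ s (interior_subset hs))
    have := hw.nonneg s (hba.trans_le (interior_subset hs))
    positivity
  have hznn : ∀ s, b ≤ s → 0 ≤ z s := fun s hs => by
    have := hw.nonneg s (hba.trans_le hs)
    have : 0 ≤ s ^ (-κ) := Real.rpow_nonneg (by linarith) _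
    simp only [hzdef]; positivity
  have hz₁np : ∀ s, b ≤ s → z₁ s ≤ 0 := by
    intro s₁ hs₁
    by_contra! hpos
    set l := z₁ s₁
    have hgrow : ∀ s, s₁ ≤ s → l * (s - s₁) ≤ z s := by
      intro s hs
      have : MonotoneOn (fun s => z s - l * (s - s₁)) (Ici s₁) := by
        refine monotoneOn_of_hasDerivWithinAt_nonneg (convex_Ici s₁)
          (f' := fun s => z₁ s - l * 1) ?_ ?_ ?_
        · intro x hx
          exact ((hz x (hs₁.trans hx)).continuousAt.sub (by fun_prop)).continuousWithinAt
        · intro x hx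
          exact ((hz x (hs₁.trans (interior_subset hx))).sub
            (((hasDerivAt_id x).sub_const s₁).const_mul l)).hasDerivWithinAt
        · intro x hx
          have := hmono (mem_Ici.2 hs₁) (mem_Ici.2 (hs₁.trans (interior_subset hx)))
            (interior_subset hx)
          linarith
      have := this (mem_Ici.2 le_rfl) (mem_Ici.2 hs) hs
      have h0 := hznn s₁ hs₁
      simp only [sub_self, mul_zero] at this
      linarith
    -- Beyond `S` the linear bound `l (s - s₁) - A` exceeds `l s / 2`.
    set S := max s₁ (2 * (l * s₁ + A) / l) with hS
    have hlow : ∀ s, S < s → (l / 2) ^ (q + 1) ≤ w s ^ (q + 1) / s ^ 2 := by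
      intro s hs
      have h1 : s₁ ≤ s := (le_max_left _ _).trans hs.le
      have h2 : 2 * (l * s₁ + A) / l < s := (le_max_right _ _).trans_lt hs
      rw [div_lt_iff₀ hpos] at h2
      have hs1 : 1 < s := by linarith
      have hr : s ^ (-κ) ≤ 1 := Real.rpow_le_one_of_one_le_of_nonpos (by linarith) (by linarith)
      have h3 := hgrow s h1
      simp only [hzdef] at h3
      have h4 : A * s ^ (-κ) ≤ A := mul_le_of_le_one_right hApos.le hr
      have h5 : l / 2 * s ≤ w s := by linarith
      have h6 : (l / 2 * s) ^ (q + 1) ≤ w s ^ (q + 1) :=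
        Real.rpow_le_rpow (by positivity) h5 (by linarith)
      rw [Real.mul_rpow (by positivity) (by linarith)] at h6
      rw [le_div_iff₀ (by positivity)]
      refine le_trans (mul_le_mul_of_nonneg_left ?_ (by positivity)) h6
      rw [← Real.rpow_natCast]
      exact Real.rpow_le_rpow_of_exponent_le hs1.le (by push_cast; linarith)
    have haS : a < S := (hba.trans_le hs₁).trans_le (le_max_left _ _)
    have hI : IntegrableOn (fun _ : ℝ => (l / 2) ^ (q + 1)) (Ioi S) := by
      refine (hint.mono_set (Ioi_subset_Ioi haS.le)).mono' aestronglyMeasurable_const ?_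
      filter_upwards [ae_restrict_mem measurableSet_Ioi] with s hs
      rw [Real.norm_of_nonneg (by positivity)]
      exact hlow s hs
    rw [integrableOn_const_iff (by simp)] at hI
    rcases hI with hI | hI
    · have : 0 < (l / 2) ^ (q + 1) := by positivity
      exact this.ne' (enorm_eq_zero.1 hI)
    · simp at hI
  have hanti : AntitoneOn z (Ici b) :=
    antitoneOn_of_hasDerivWithinAt_nonpos (convex_Ici b)
      (fun s hs => (hz s hs).continuousAt.continuousWithinAt)
      (fun s hs => (hz s (interior_subset hs)).hasDerivWithinAt)
      fun s hs => hz₁np s (interior_subset hs)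
  obtain ⟨L, hL⟩ : ∃ L, Tendsto z atTop (𝓝 L) := by
    have h1 : Antitone fun s => z (max s b) := fun x y hxy =>
      hanti (mem_Ici.2 (le_max_right _ _)) (mem_Ici.2 (le_max_right _ _)) (max_le_max_right b hxy)
    have h2 := tendsto_atTop_ciInf h1 ⟨0, by
      rintro _ ⟨s, rfl⟩
      exact hznn _ (le_max_right _ _)⟩
    refine ⟨_, h2.congr' ?_⟩
    filter_upwards [eventually_ge_atTop b] with s hs
    rw [max_eq_left hs]
  have hLnn : 0 ≤ L := ge_of_tendsto hL ((eventually_ge_atTop b).mono hznn)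
  have hwL : Tendsto w atTop (𝓝 L) := by
    have h1 := hL.sub ((tendsto_rpow_neg_atTop hκ).const_mul A)
    simp only [mul_zero, sub_zero] at h1
    exact h1.congr fun s => by simp only [hzdef]; ring
  rcases hLnn.eq_or_lt with h0 | hLpos
  · rwa [← h0] at hwL
  exfalso
  obtain ⟨S, hS⟩ := eventually_atTop.1 (hwL.eventually (lt_mem_nhds (half_lt_self hLpos)))
  set T := max S b
  have hTb : b ≤ T := le_max_right _ _
  set c : ℝ := k * (L / 2) ^ q / 2 with hc
  have hcpos : 0 < c := by positivity
  have hz₂' : ∀ s, T ≤ s → 0 ≤ z₂ s + c * (-(s ^ 2)⁻¹) := by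
    intro s hs
    have h1 := hz₂ s (hTb.trans hs)
    have h2 : (L / 2) ^ q ≤ w s ^ q :=
      Real.rpow_le_rpow (by positivity) (hS s ((le_max_left _ _).trans hs)).le (by linarith)
    have h3 : c / s ^ 2 ≤ k * w s ^ q / 2 / s ^ 2 := by
      rw [hc]; gcongr
    rw [mul_neg, ← div_eq_mul_inv]
    linarith
  have hTpos : ∀ s, T ≤ s → 0 < s := fun s hs => by linarith [hTb.trans hs]
  have hmono' : MonotoneOn (fun s => z₁ s + c * s⁻¹) (Ici T) := by
    refine monotoneOn_of_hasDerivWithinAt_nonneg (convex_Ici T)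
      (f' := fun s => z₂ s + c * (-(s ^ 2)⁻¹)) ?_ ?_ fun s hs => hz₂' s (interior_subset hs)
    · intro s hs
      exact ((hz₁ s (hTb.trans hs)).add
        ((hasDerivAt_inv (hTpos s hs).ne').const_mul c)).continuousAt.continuousWithinAt
    · intro s hs
      have hs' : T ≤ s := interior_subset hs
      exact ((hz₁ s (hTb.trans hs')).add
        ((hasDerivAt_inv (hTpos s hs').ne').const_mul c)).hasDerivWithinAt
  have hz₁' : ∀ s, T ≤ s → z₁ s + c * s⁻¹ ≤ 0 := by
    intro s hs
    -- By monotonicity and `z₁ t ≤ 0`, the value at `s` is at most `c / t` for every later `t`.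
    have hlim : Tendsto (fun t : ℝ => c * t⁻¹) atTop (𝓝 0) := by
      simpa using (tendsto_inv_atTop_zero (𝕜 := ℝ)).const_mul c
    refine ge_of_tendsto hlim ?_
    filter_upwards [eventually_ge_atTop s] with t ht
    have h1 := hmono' (mem_Ici.2 hs) (mem_Ici.2 (hs.trans ht)) ht
    have h2 := hz₁np t (hTb.trans (hs.trans ht))
    simp only at h1
    linarith
  have hanti' : AntitoneOn (fun s => z s + c * Real.log s) (Ici T) := by
    refine antitoneOn_of_hasDerivWithinAt_nonpos (convex_Ici T)
      (f' := fun s => z₁ s + c * s⁻¹) ?_ ?_ fun s hs => hz₁' s (interior_subset hs)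
    · intro s hs
      exact ((hz s (hTb.trans hs)).add
        ((Real.hasDerivAt_log (hTpos s hs).ne').const_mul c)).continuousAt.continuousWithinAt
    · intro s hs
      have hs' : T ≤ s := interior_subset hs
      exact ((hz s (hTb.trans hs')).add
        ((Real.hasDerivAt_log (hTpos s hs').ne').const_mul c)).hasDerivWithinAt
  have hlog : Tendsto (fun s => c * Real.log s) atTop atTop :=
    Real.tendsto_log_atTop.const_mul_atTop hcpos
  obtain ⟨s, hs, hsT⟩ := ((hlog.eventually_gt_atTop (z T + c * Real.log T)).and
    (eventually_ge_atTop T)).exists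
  have h1 := hanti' (mem_Ici.2 le_rfl) (mem_Ici.2 hsT) hsT
  have h2 := hznn s (hTb.trans hsT)
  simp only at h1
  linarith

end IsEmdenSolution

namespace IsEmdenSolution

variable {a k κ p q : ℝ} {w w₁ : ℝ → ℝ}

/-- When `k c ^ q = m c`, the barrier `Y` satisfies `Y'' ≥ k Y ^ q / s ^ 2`, the surplus being the
factor `1 + (m + 1) / T` with `T = log s + B`. The `w ^ p` term only lowers `w''`, so `(w - Y)'' <
0` wherever `w < Y`; a large `B` settles the starting point. -/
theorem exists_logBarrier_le (hw : IsEmdenSolution a k κ p q w w₁) (hk : 0 < k)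
    (hq : 1 < q) (hlim : Tendsto w atTop (𝓝 0)) {s₁ : ℝ} (hs₁ : a < s₁)
    (hs₁' : 1 < s₁) (hpos : 0 < w s₁) :
    ∃ B, 0 < B ∧
      ∀ s, s₁ ≤ s → logBarrier ((1 / (q - 1) / k) ^ (1 / (q - 1))) B (1 / (q - 1)) s ≤ w s := by
  have hq1 : 0 < q - 1 := sub_pos.2 hq
  set m : ℝ := 1 / (q - 1) with hm
  have hmpos : 0 < m := by positivity
  set c : ℝ := (m / k) ^ m with hc
  have hcpos : 0 < c := by positivity
  have hcq : k * c ^ q = m * c := by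
    have h1 : c ^ q = c ^ (q - 1) * c := by
      rw [← Real.rpow_add_one hcpos.ne']; ring_nf
    rw [h1, hc, ← Real.rpow_mul (by positivity), hm, one_div_mul_cancel hq1.ne', Real.rpow_one,
      ← hm, ← hc]
    field_simp
  obtain ⟨B, hBw, hB⟩ : ∃ B, logBarrier c B m s₁ < w s₁ ∧ 0 < B := by
    have h1 : Tendsto (fun B => Real.log s₁ + B) atTop atTop :=
      tendsto_atTop_add_const_left _ _ tendsto_id
    have h2 := ((tendsto_rpow_neg_atTop hmpos).comp h1).const_mul c
    rw [mul_zero] at h2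
    exact ((h2.eventually (gt_mem_nhds hpos)).and (eventually_gt_atTop 0)).exists
  refine ⟨B, hB, fun s hs => ?_⟩
  have hs0 : ∀ s, s₁ ≤ s → 0 < s := fun s hs => by linarith
  have hT : ∀ s, s₁ ≤ s → 0 < Real.log s + B := fun s hs => by
    have := Real.log_nonneg (x := s) (by linarith)
    linarith
  have key := nonneg_of_neg_imp_deriv2_neg (b := s₁)
    (fun s hs => (hw.hasDerivAt s (by linarith)).sub (hasDerivAt_logBarrier (c := c) (m := m)
      (hs0 s hs) (hT s hs)))
    (fun s hs => (hw.hasDerivAt_deriv s (by linarith)).sub (hasDerivAt_deriv_logBarrier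
      (hs0 s hs) (hT s hs))) (by simp only [Pi.sub_apply]; linarith)
    (by simpa using! hlim.sub (tendsto_logBarrier (c := c) (B := B) hmpos))
    (fun s hs hneg => ?_) s hs
  · simpa using! key
  · have hs' := hs0 s hs
    have hT' := hT s hs
    simp only [Pi.sub_apply] at hneg
    set T := Real.log s + B with hTdef
    have hY : logBarrier c B m s = c * T ^ (-m) := rfl
    rw [hY] at hneg
    rw [← sub_div]
    refine div_neg_of_neg_of_pos ?_ (by positivity)
    have hwnn := hw.nonneg s (by linarith)
    have h1 : w s ^ q < (c * T ^ (-m)) ^ q :=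
      Real.rpow_lt_rpow hwnn (by linarith) (by linarith)
    have h2 : (c * T ^ (-m)) ^ q = c ^ q * T ^ (-m - 1) := by
      rw [Real.mul_rpow hcpos.le (by positivity), ← Real.rpow_mul hT'.le]
      congr 2
      rw [hm]; field_simp; ring
    have h3 : k * w s ^ q < m * c * T ^ (-m - 1) := by
      calc k * w s ^ q < k * (c ^ q * T ^ (-m - 1)) := by
            rw [← h2]; exact mul_lt_mul_of_pos_left h1 hk
        _ = _ := by rw [← mul_assoc, hcq]
    have h4 : 0 ≤ m * c * T ^ (-m - 1) * ((m + 1) / T) := by positivity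
    have h5 : 0 ≤ k * (s ^ (-κ) * w s ^ p) := by positivity
    linarith

/-- A logarithmic lower bound beats `s ^ (-η)` for every `η > 0`, so `w ^ (q - p)` cannot be as
small as `s ^ (-κ)`. -/
theorem eventually_perturbation_le {p q κ c B m : ℝ} {w : ℝ → ℝ} (hpq : p < q) (hκ : 0 < κ)
    (hc : 0 < c) (hB : 0 < B)
    (h : ∀ᶠ s in atTop, logBarrier c B m s ≤ w s) {ε : ℝ} (hε : 0 < ε) :
    ∀ᶠ s in atTop, s ^ (-κ) * w s ^ p ≤ ε * w s ^ q := by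
  have hqp : 0 < q - p := sub_pos.2 hpq
  -- Half of the decay `s ^ (-κ)` pays for `w ^ (q - p) ≥ s ^ (-κ / 2)`; the other half becomes
  -- smaller than `ε`.
  set η : ℝ := κ / 2 / (q - p) with hη
  have hηpos : 0 < η := by positivity
  have h1 : ∀ᶠ s in atTop, (Real.log s + B) ^ m ≤ c * s ^ η := by
    have h0 : Tendsto (fun s => 1 + B / Real.log s) atTop (𝓝 (1 + 0)) :=
      tendsto_const_nhds.add (tendsto_const_nhds.div_atTop Real.tendsto_log_atTop)
    have h2 := (isLittleO_log_rpow_rpow_atTop m hηpos).tendsto_div_nhds_zero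
    have h3 := (h0.rpow_const (p := m) (Or.inl (by norm_num))).mul h2
    rw [mul_zero] at h3
    filter_upwards [h3.eventually (gt_mem_nhds hc), eventually_gt_atTop 1] with s hs hs1
    have hl : 0 < Real.log s := Real.log_pos hs1
    have hsη : 0 < s ^ η := by positivity
    have e : Real.log s + B = (1 + B / Real.log s) * Real.log s := by field_simp
    rw [e, Real.mul_rpow (by positivity) hl.le]
    rw [← mul_div_assoc, div_lt_iff₀ hsη] at hs
    exact hs.le
  have h2 : ∀ᶠ s : ℝ in atTop, s ^ (-(κ / 2)) < ε :=
    (tendsto_rpow_neg_atTop (half_pos hκ)).eventually (gt_mem_nhds hε)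
  filter_upwards [h, h1, h2, eventually_gt_atTop 1] with s hw hs1 hs2 hs
  have hs0 : 0 < s := by linarith
  have hT : 0 < Real.log s + B := by linarith [Real.log_pos hs]
  have hlow : s ^ (-η) ≤ w s := by
    refine le_trans ?_ hw
    rw [logBarrier, Real.rpow_neg hs0.le, Real.rpow_neg hT.le, ← div_eq_mul_inv,
      le_div_iff₀ (by positivity), inv_mul_le_iff₀ (by positivity)]
    linarith
  have hwpos : 0 < w s := lt_of_lt_of_le (by positivity) hlow
  have h3 : s ^ (-(κ / 2)) ≤ w s ^ (q - p) := by
    refine le_trans (le_of_eq ?_) (Real.rpow_le_rpow (by positivity) hlow hqp.le)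
    rw [← Real.rpow_mul hs0.le, hη]
    congr 1
    field_simp
  have h4 : s ^ (-κ) = s ^ (-(κ / 2)) * s ^ (-(κ / 2)) := by
    rw [← Real.rpow_add hs0]; ring_nf
  have h5 : w s ^ q = w s ^ (q - p) * w s ^ p := by
    rw [← Real.rpow_add hwpos]; ring_nf
  rw [h4, h5, ← mul_assoc]
  gcongr

/-- Now `w'' ≥ (1 - ε) k w ^ q / s ^ 2`. While `T = log s + B ≥ 1 / ε`, the factor `1 + (m + 1) / T`
of the barrier is at most `1 + (m + 1) ε`, and the enlarged constant absorbs both losses. -/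
theorem exists_le_logBarrier (hw : IsEmdenSolution a k κ p q w w₁) (ha : 0 < a) (hk : 0 < k)
    (hq : 1 < q) (hlim : Tendsto w atTop (𝓝 0)) {ε : ℝ} (hε : 0 < ε) (hε1 : ε < 1)
    (hev : ∀ᶠ s in atTop, s ^ (-κ) * w s ^ p ≤ ε * w s ^ q) :
    ∃ B, ∀ᶠ s in atTop, w s ≤ logBarrier
      ((1 / (q - 1) * (1 + (1 / (q - 1) + 1) * ε) / ((1 - ε) * k)) ^ (1 / (q - 1))) B
      (1 / (q - 1)) s := by
  have hq1 : 0 < q - 1 := sub_pos.2 hq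
  have hε1' : 0 < 1 - ε := sub_pos.2 hε1
  set m : ℝ := 1 / (q - 1) with hm
  have hmpos : 0 < m := by positivity
  set c : ℝ := (m * (1 + (m + 1) * ε) / ((1 - ε) * k)) ^ m with hc
  have hcpos : 0 < c := by positivity
  have hcq : (1 - ε) * k * c ^ q = m * c * (1 + (m + 1) * ε) := by
    have h1 : c ^ q = c ^ (q - 1) * c := by
      rw [← Real.rpow_add_one hcpos.ne']; ring_nf
    rw [h1, hc, ← Real.rpow_mul (by positivity), hm, one_div_mul_cancel hq1.ne', Real.rpow_one,
      ← hm, ← hc]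
    field_simp
  have hK : 0 < c * (1 / ε) ^ (-m) := by positivity
  obtain ⟨S, hS⟩ := eventually_atTop.1 (hev.and
    ((hlim.eventually (gt_mem_nhds hK)).and (eventually_gt_atTop a)))
  -- This puts `T = 1 / ε` at `S`. The barrier value there, `c (1 / ε) ^ (-m)`, does not depend on
  -- `S`, which is why `S` could be chosen beforehand with `w` below it.
  set B : ℝ := 1 / ε - Real.log S with hB
  refine ⟨B, (eventually_ge_atTop S).mono fun s hs => ?_⟩
  have hs0 : ∀ s, S ≤ s → 0 < s := fun s hs => ha.trans (hS s hs).2.2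
  have hT : ∀ s, S ≤ s → 1 / ε ≤ Real.log s + B := fun s hs => by
    have := Real.log_le_log (hs0 S le_rfl) hs
    rw [hB]; linarith
  have hTpos : ∀ s, S ≤ s → 0 < Real.log s + B := fun s hs =>
    lt_of_lt_of_le (by positivity) (hT s hs)
  have key := nonneg_of_neg_imp_deriv2_neg (b := S)
    (fun s hs => (hasDerivAt_logBarrier (c := c) (m := m) (hs0 s hs) (hTpos s hs)).sub
      (hw.hasDerivAt s (hS s hs).2.2))
    (fun s hs => (hasDerivAt_deriv_logBarrier (hs0 s hs) (hTpos s hs)).sub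
      (hw.hasDerivAt_deriv s (hS s hs).2.2)) ?_
    (by simpa using! (tendsto_logBarrier (c := c) (B := B) hmpos).sub hlim)
    (fun s hs hneg => ?_) s hs
  · simpa using! key
  · have h1 := (hS S le_rfl).2.1
    have h2 : logBarrier c B m S = c * (1 / ε) ^ (-m) := by
      rw [logBarrier, hB]; ring_nf
    simp only [Pi.sub_apply, h2]
    linarith
  · have hs' := hs0 s hs
    have hT' := hTpos s hs
    have hTε := hT s hs
    simp only [Pi.sub_apply] at hneg
    set T := Real.log s + B with hTdef
    have hY : logBarrier c B m s = c * T ^ (-m) := rfl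
    rw [hY] at hneg
    rw [← sub_div]
    refine div_neg_of_neg_of_pos ?_ (by positivity)
    have h1 : (c * T ^ (-m)) ^ q < w s ^ q :=
      Real.rpow_lt_rpow (by positivity) (by linarith) (by linarith)
    have h2 : (c * T ^ (-m)) ^ q = c ^ q * T ^ (-m - 1) := by
      rw [Real.mul_rpow hcpos.le (by positivity), ← Real.rpow_mul hT'.le]
      congr 2
      rw [hm]; field_simp; ring
    have h3 : m * c * (1 + (m + 1) * ε) * T ^ (-m - 1) < (1 - ε) * k * w s ^ q := by
      rw [← hcq, mul_assoc, ← h2]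
      exact mul_lt_mul_of_pos_left h1 (by positivity)
    have h4 : (m + 1) / T ≤ (m + 1) * ε := by
      rw [div_le_iff₀ hT', mul_assoc]
      refine le_mul_of_one_le_right (by positivity) ?_
      rw [div_le_iff₀ hε] at hTε
      linarith
    have h5 : m * c * T ^ (-m - 1) * (1 + (m + 1) / T) ≤
        m * c * (1 + (m + 1) * ε) * T ^ (-m - 1) := by
      rw [mul_right_comm (m * c)]
      gcongr
    have h6 := mul_le_mul_of_nonneg_left (hS s hs).1 hk.le
    linarith

/-- Sharp logarithmic decay of positive solutions. -/
theorem tendsto_mul_log_rpow (hw : IsEmdenSolution a k κ p q w w₁) (ha : 0 < a) (hk : 0 < k)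
    (hκ : 0 < κ) (hp : 0 < p) (hpq : p < q) (hq : 1 < q)
    (hint : IntegrableOn (fun s => w s ^ (q + 1) / s ^ 2) (Ioi a))
    (hpos : ∃ s, a < s ∧ 1 < s ∧ 0 < w s) :
    Tendsto (fun s => w s * Real.log s ^ (1 / (q - 1))) atTop
      (𝓝 ((1 / (q - 1) / k) ^ (1 / (q - 1)))) := by
  have hlim := hw.tendsto_zero ha hk hκ hp hpq hq hint
  obtain ⟨s₁, hs₁, hs₁', hws₁⟩ := hpos
  have hq1 : 0 < q - 1 := sub_pos.2 hq
  obtain ⟨B, hB, hlow⟩ := hw.exists_logBarrier_le hk hq hlim hs₁ hs₁' hws₁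
  set m : ℝ := 1 / (q - 1) with hm
  have hmpos : 0 < m := by positivity
  set c : ℝ := (m / k) ^ m with hc
  have hcpos : 0 < c := by positivity
  have hlow' : ∀ᶠ s in atTop, logBarrier c B m s ≤ w s := (eventually_ge_atTop s₁).mono hlow
  have hlog : ∀ᶠ s in atTop, 0 ≤ Real.log s ^ m := by
    filter_upwards [eventually_ge_atTop 1] with s hs
    exact Real.rpow_nonneg (Real.log_nonneg hs) _
  refine tendsto_order.2 ⟨fun x hx => ?_, fun x hx => ?_⟩
  · filter_upwards [hlow', hlog,
      (tendsto_logBarrier_mul_log (c := c) (B := B) (m := m)).eventually (lt_mem_nhds hx)]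
      with s h1 h2 h3
    exact h3.trans_le (mul_le_mul_of_nonneg_right h1 h2)
  · have hcε : Tendsto (fun ε => (m * (1 + (m + 1) * ε) / ((1 - ε) * k)) ^ m) (𝓝[>] 0) (𝓝 c) := by
      have h1 : ContinuousAt (fun ε => (m * (1 + (m + 1) * ε) / ((1 - ε) * k)) ^ m) 0 := by
        refine ContinuousAt.rpow_const (ContinuousAt.div (by fun_prop) (by fun_prop) ?_)
          (Or.inr hmpos.le)
        simpa using hk.ne'
      have h2 := h1.tendsto
      simp only [mul_zero, add_zero, mul_one, sub_zero, one_mul] at h2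
      exact h2.mono_left nhdsWithin_le_nhds
    obtain ⟨ε, hεx, hε0, hε1⟩ := ((hcε.eventually (gt_mem_nhds hx)).and
      (Ioo_mem_nhdsGT (zero_lt_one' ℝ))).exists
    have hev := eventually_perturbation_le hpq hκ hcpos hB hlow' hε0
    obtain ⟨B', hB'⟩ := hw.exists_le_logBarrier ha hk hq hlim hε0 hε1 hev
    filter_upwards [hB', hlog, (tendsto_logBarrier_mul_log (B := B') (m := m)).eventually
      (gt_mem_nhds hεx)] with s h1 h2 h3
    exact (mul_le_mul_of_nonneg_right h1 h2).trans_lt h3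

end IsEmdenSolution

/-! ### From distributional to classical solutions. -/

/-- Regularity of distributional solutions of the Emden-Fowler equation. -/
theorem exists_isEmdenSolution {a k κ p q : ℝ} {w : ℝ → ℝ} (ha : 0 ≤ a) (hp : 0 < p) (hq : 0 < q)
    (hw : LocallyIntegrableOn w (Ioi a))
    (hh : LocallyIntegrableOn (fun s => k * (w s ^ q - s ^ (-κ) * w s ^ p) / s ^ 2) (Ioi a))
    (hnn : ∀ s, a < s → 0 ≤ w s)
    (H : ∀ ψ, IsTest a ψ → ∫ s, w s * deriv (deriv ψ) s =
      ∫ s, k * (w s ^ q - s ^ (-κ) * w s ^ p) / s ^ 2 * ψ s) :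
    ∃ v v₁, IsEmdenSolution a k κ p q v v₁ ∧ ∀ᵐ s, s ∈ Ioi a → w s = v s := by
  set x₀ := a + 1
  have hx₀ : a < x₀ := lt_add_one a
  obtain ⟨c₁, c₂, hae⟩ := ae_eq_double_primitive hw hh hx₀ H
  set h : ℝ → ℝ := fun s => k * (w s ^ q - s ^ (-κ) * w s ^ p) / s ^ 2
  set v₁ : ℝ → ℝ := fun t => c₂ + ∫ s in x₀..t, h s with hv₁
  set v : ℝ → ℝ := fun x => c₁ + ∫ t in x₀..x, v₁ t with hv
  have hder : ∀ {g : ℝ → ℝ}, ContinuousOn g (Ioi a) → ∀ s, a < s →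
      HasDerivAt (fun x => ∫ t in x₀..x, g t) (g s) s := by
    intro g hg s hs
    have hloc : LocallyIntegrableOn g (Ioi a) := hg.locallyIntegrableOn measurableSet_Ioi
    exact intervalIntegral.integral_hasDerivAt_right
      (intervalIntegrable_of_locallyIntegrableOn_Ioi hloc hx₀ hs)
      (hg.stronglyMeasurableAtFilter isOpen_Ioi s hs) (hg.continuousAt (Ioi_mem_nhds hs))
  have hv₁c : ContinuousOn v₁ (Ioi a) := continuousOn_const.add (continuousOn_primitive_Ioi hh hx₀)
  have hvd : ∀ s, a < s → HasDerivAt v (v₁ s) s := fun s hs => (hder hv₁c s hs).const_add c₁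
  have hvc : ContinuousOn v (Ioi a) := fun s hs => (hvd s hs).continuousAt.continuousWithinAt
  have hvnn : ∀ s, a < s → 0 ≤ v s := by
    intro s hs
    by_contra! hneg
    have h1 : ∀ᶠ x in 𝓝 s, v x < 0 ∧ x ∈ Ioi a :=
      ((hvc.continuousAt (Ioi_mem_nhds hs)).eventually (gt_mem_nhds hneg)).and (Ioi_mem_nhds hs)
    -- A negative value of the continuous `v` would persist on a neighbourhood, a set of positive
    -- measure on which `w = v` fails.
    have h2 : volume {x | v x < 0 ∧ x ∈ Ioi a} = 0 := by
      refine measure_mono_null (fun x hx => ?_) (ae_iff.1 hae)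
      intro hx'
      have := hx' hx.2
      have h3 := hnn x hx.2
      rw [this] at h3
      exact absurd hx.1 (not_lt.2 h3)
    exact (Measure.measure_pos_of_mem_nhds volume h1).ne' h2
  -- The continuous version of `h`: both have the same primitives, and that of `g` is differentiable
  -- everywhere.
  set g : ℝ → ℝ := fun s => k * (v s ^ q - s ^ (-κ) * v s ^ p) / s ^ 2 with hg
  have hgc : ContinuousOn g (Ioi a) := by
    have hne : ∀ s ∈ Ioi a, s ≠ 0 := fun s hs => (ha.trans_lt hs).ne'
    refine ContinuousOn.div (continuousOn_const.mul (ContinuousOn.sub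
      (hvc.rpow_const fun s _ => Or.inr hq.le) (ContinuousOn.mul
      (continuousOn_id.rpow_const fun s hs => Or.inl (hne s hs))
      (hvc.rpow_const fun s _ => Or.inr hp.le)))) (by fun_prop) fun s hs => by
        have := hne s hs; positivity
  have hv₁g : ∀ s, a < s → v₁ s = c₂ + ∫ t in x₀..s, g t := by
    intro s hs
    change c₂ + _ = c₂ + _
    congr 1
    refine intervalIntegral.integral_congr_ae ?_
    filter_upwards [hae] with t ht htm
    have hta : t ∈ Ioi a := lt_of_le_of_lt (le_min hx₀.le hs.le) htm.1
    simp only [h, hg]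
    rw [ht hta]
  refine ⟨v, v₁, ⟨hvd, fun s hs => ?_, hvnn⟩, hae⟩
  refine ((hder hgc s hs).const_add c₂).congr_of_eventuallyEq ?_
  filter_upwards [Ioi_mem_nhds hs] with t ht using hv₁g t ht

/-! ### Radial test functions adapted to the Hardy operator. -/

section PowerTest

variable {a α ν : ℝ} {χ : ℝ → ℝ}

/-- The function `ρ ^ (-ν/2) χ (ρ ^ (-α/2))` on `(0, ∞)`, extended by zero. With `ρ = |x|²` this
is the radial test function `|x| ^ (-ν) χ (|x| ^ (-α))`. -/
noncomputable def powerTest (α ν : ℝ) (χ : ℝ → ℝ) (ρ : ℝ) : ℝ :=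
  if 0 < ρ then ρ ^ (-(ν / 2)) * χ (ρ ^ (-(α / 2))) else 0

theorem powerTest_of_pos {ρ : ℝ} (hρ : 0 < ρ) :
    powerTest α ν χ ρ = ρ ^ (-(ν / 2)) * χ (ρ ^ (-(α / 2))) := if_pos hρ

/-- The decreasing map `s = ρ ^ (-α/2)` carries the support of `χ` away from `ρ = 0`, where the
powers and the potential are singular, and inside `ρ < a ^ (-2/α)`, which is `R ^ 2` for `a = R ^
(-α)`. -/
theorem exists_powerTest_eq_zero (ha : 0 < a) (hα : 0 < α) (hχ : IsTest a χ) :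
    ∃ b c, 0 < b ∧ c < a ^ (-(2 / α)) ∧ ∀ ρ, ρ ∉ Icc b c → powerTest α ν χ ρ = 0 := by
  obtain ⟨b, c, hb, hb', hc', h⟩ := hχ.exists_Icc (lt_add_one a)
  have hbpos : 0 < b := ha.trans hb
  have hcpos : 0 < c := hbpos.trans (hb'.trans hc')
  refine ⟨c ^ (-(2 / α)), b ^ (-(2 / α)), by positivity,
    Real.rpow_lt_rpow_of_neg ha hb (by simp; positivity), fun ρ hρ => ?_⟩
  unfold powerTest
  split_ifs with hρ0
  · rw [h, mul_zero]
    rintro ⟨h1, h2⟩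
    have e : (ρ ^ (-(α / 2))) ^ (-(2 / α)) = ρ := by
      rw [← Real.rpow_mul hρ0.le]
      have : -(α / 2) * -(2 / α) = 1 := by field_simp
      rw [this, Real.rpow_one]
    have hneg : -(2 / α) ≤ 0 := by simp; positivity
    refine hρ ⟨?_, ?_⟩
    · rw [← e]
      exact Real.rpow_le_rpow_of_nonpos (by positivity) h2.le hneg
    · conv_lhs => rw [← e]
      exact Real.rpow_le_rpow_of_nonpos hbpos h1.le hneg
  · rfl

theorem contDiff_powerTest (ha : 0 < a) (hα : 0 < α) (hχ : IsTest a χ) :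
    ContDiff ℝ ∞ (powerTest α ν χ) := by
  obtain ⟨b, c, hb, -, h⟩ := exists_powerTest_eq_zero (ν := ν) ha hα hχ
  rw [contDiff_iff_contDiffAt]
  intro ρ
  rcases lt_or_ge 0 ρ with hρ | hρ
  · have h1 : ContDiffAt ℝ ∞ (fun ρ => ρ ^ (-(ν / 2)) * χ (ρ ^ (-(α / 2)))) ρ :=
      (Real.contDiffAt_rpow_const_of_ne hρ.ne').mul
        (hχ.smooth.contDiffAt.comp ρ (Real.contDiffAt_rpow_const_of_ne hρ.ne'))
    refine h1.congr_of_eventuallyEq ?_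
    filter_upwards [Ioi_mem_nhds hρ] with x hx using powerTest_of_pos hx
  · refine (contDiffAt_const (c := (0 : ℝ))).congr_of_eventuallyEq ?_
    filter_upwards [Iio_mem_nhds (hρ.trans_lt hb)] with x hx
    exact h x fun hx' => absurd hx'.1 (not_le.2 hx)

theorem deriv_powerTest (hχ : ContDiff ℝ ∞ χ) {ρ : ℝ} (hρ : 0 < ρ) :
    deriv (powerTest α ν χ) ρ = -(ν / 2) * (ρ ^ (-(ν / 2) - 1) * χ (ρ ^ (-(α / 2)))) -
      α / 2 * (ρ ^ (-(ν / 2) - α / 2 - 1) * deriv χ (ρ ^ (-(α / 2)))) := by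
  have h1 := Real.hasDerivAt_rpow_const (x := ρ) (p := -(ν / 2)) (Or.inl hρ.ne')
  have h2 := Real.hasDerivAt_rpow_const (x := ρ) (p := -(α / 2)) (Or.inl hρ.ne')
  have h3 := ((hχ.differentiable (by simp)) (ρ ^ (-(α / 2)))).hasDerivAt.comp ρ h2
  have h4 : HasDerivAt (powerTest α ν χ) _ ρ := (h1.mul h3).congr_of_eventuallyEq (by
    filter_upwards [Ioi_mem_nhds hρ] with x hx using powerTest_of_pos hx)
  rw [h4.deriv]
  have e : ρ ^ (-(ν / 2) - α / 2 - 1) = ρ ^ (-(ν / 2)) * ρ ^ (-(α / 2) - 1) := by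
    rw [← Real.rpow_add hρ]; ring_nf
  rw [e]
  simp only [Function.comp_apply]
  ring

theorem deriv_deriv_powerTest (hχ : ContDiff ℝ ∞ χ) {ρ : ℝ} (hρ : 0 < ρ) :
    deriv (deriv (powerTest α ν χ)) ρ =
      ν / 2 * (ν / 2 + 1) * (ρ ^ (-(ν / 2) - 2) * χ (ρ ^ (-(α / 2)))) +
      α / 2 * (ν + α / 2 + 1) * (ρ ^ (-(ν / 2) - α / 2 - 2) * deriv χ (ρ ^ (-(α / 2)))) +
      α ^ 2 / 4 * (ρ ^ (-(ν / 2) - α - 2) * deriv (deriv χ) (ρ ^ (-(α / 2)))) := by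
  have hχ' : ContDiff ℝ ∞ (deriv χ) := (contDiff_infty_iff_deriv.1 hχ).2
  have h1 := Real.hasDerivAt_rpow_const (x := ρ) (p := -(ν / 2) - 1) (Or.inl hρ.ne')
  have h1' := Real.hasDerivAt_rpow_const (x := ρ) (p := -(ν / 2) - α / 2 - 1) (Or.inl hρ.ne')
  have h2 := Real.hasDerivAt_rpow_const (x := ρ) (p := -(α / 2)) (Or.inl hρ.ne')
  have h3 := ((hχ.differentiable (by simp)) (ρ ^ (-(α / 2)))).hasDerivAt.comp ρ h2
  have h3' := ((hχ'.differentiable (by simp)) (ρ ^ (-(α / 2)))).hasDerivAt.comp ρ h2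
  have h4 : HasDerivAt (deriv (powerTest α ν χ)) _ ρ :=
    (((h1.mul h3).const_mul (-(ν / 2))).sub ((h1'.mul h3').const_mul (α / 2))).congr_of_eventuallyEq
      (by filter_upwards [Ioi_mem_nhds hρ] with x hx using deriv_powerTest hχ hx)
  rw [h4.deriv]
  have e1 : ρ ^ (-(ν / 2) - 1 - 1) = ρ ^ (-(ν / 2) - 2) := by ring_nf
  have e2 : ρ ^ (-(ν / 2) - 1) * ρ ^ (-(α / 2) - 1) = ρ ^ (-(ν / 2) - α / 2 - 2) := by
    rw [← Real.rpow_add hρ]; ring_nf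
  have e3 : ρ ^ (-(ν / 2) - α / 2 - 1 - 1) = ρ ^ (-(ν / 2) - α / 2 - 2) := by ring_nf
  have e4 : ρ ^ (-(ν / 2) - α / 2 - 1) * ρ ^ (-(α / 2) - 1) = ρ ^ (-(ν / 2) - α - 2) := by
    rw [← Real.rpow_add hρ]; ring_nf
  simp only [Function.comp_apply]
  rw [e1, e3, ← e4, ← e2]
  ring

/-- The radial operator `Δ + μ / |x|²` on `powerTest`, in the variable `ρ = |x|²`. -/
theorem hardy_powerTest {n μ : ℝ} (hχ : ContDiff ℝ ∞ χ) (hα : α = n - 2 - 2 * ν)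
    (hν : ν ^ 2 - (n - 2) * ν + μ = 0) {ρ : ℝ} (hρ : 0 < ρ) :
    2 * n * deriv (powerTest α ν χ) ρ + 4 * ρ * deriv (deriv (powerTest α ν χ)) ρ +
      μ * (powerTest α ν χ ρ / ρ) =
      α ^ 2 * (ρ ^ (-(ν / 2) - α - 1) * deriv (deriv χ) (ρ ^ (-(α / 2)))) := by
  rw [deriv_deriv_powerTest hχ hρ, deriv_powerTest hχ hρ, powerTest_of_pos hρ]
  have e0 : ρ ^ (-(ν / 2)) = ρ ^ (-(ν / 2) - 2) * ρ * ρ := by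
    rw [← Real.rpow_add_one hρ.ne', ← Real.rpow_add_one hρ.ne']; ring_nf
  have e1 : ρ ^ (-(ν / 2) - 1) = ρ ^ (-(ν / 2) - 2) * ρ := by
    rw [← Real.rpow_add_one hρ.ne']; ring_nf
  have e2 : ρ ^ (-(ν / 2) - α / 2 - 1) = ρ ^ (-(ν / 2) - α / 2 - 2) * ρ := by
    rw [← Real.rpow_add_one hρ.ne']; ring_nf
  have e3 : ρ ^ (-(ν / 2) - α - 1) = ρ ^ (-(ν / 2) - α - 2) * ρ := by
    rw [← Real.rpow_add_one hρ.ne']; ring_nf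
  have e4 : ρ ^ (-(ν / 2) - 2) * ρ * ρ * χ (ρ ^ (-(α / 2))) / ρ =
      ρ ^ (-(ν / 2) - 2) * ρ * χ (ρ ^ (-(α / 2))) := by field_simp
  rw [e0, e1, e2, e3, e4]
  -- The coefficient of `χ` is the indicial polynomial at `ν`; that of `χ'` vanishes by the choice
  -- of `α`.
  linear_combination (ρ ^ (-(ν / 2) - 2) * ρ * χ (ρ ^ (-(α / 2)))) * hν +
    (α * ρ ^ (-(ν / 2) - α / 2 - 2) * ρ * deriv χ (ρ ^ (-(α / 2)))) * hα

end PowerTest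

/-! ### The weak Laplacian on radial test functions. -/

section WeakGradient

variable {N : ℕ} {Ω : Opens (Euc N)} {R c : ℝ}

theorem closedBall_sqrt_subset (hR : 0 < R) (hΩ : Metric.ball (0 : Euc N) R ⊆ Ω) (hc : c < R ^ 2) :
    Metric.closedBall (0 : Euc N) (Real.sqrt c) ⊆ Ω := by
  intro x hx
  refine hΩ ?_
  rw [mem_closedBall_zero_iff] at hx
  rw [mem_ball_zero_iff]
  refine hx.trans_lt ?_
  exact (Real.sqrt_lt' hR).2 hc

theorem eq_zero_of_notMem_closedBall {E : Type*} [Zero E] {g : Euc N → E}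
    (hg : ∀ x, c < ‖x‖ ^ 2 → g x = 0) (x : Euc N)
    (hx : x ∉ Metric.closedBall (0 : Euc N) (Real.sqrt c)) : g x = 0 := by
  refine hg x ?_
  rw [mem_closedBall_zero_iff, not_le] at hx
  exact (Real.sqrt_lt' (lt_of_le_of_lt (Real.sqrt_nonneg c) hx)).1 hx

/-- A smooth function supported in a small ball, as a test function. -/
noncomputable def ballTest (hR : 0 < R) (hΩ : Metric.ball (0 : Euc N) R ⊆ Ω) (hc : c < R ^ 2)
    (F : Euc N → ℝ) (hF : ContDiff ℝ ∞ F) (h : ∀ x, c < ‖x‖ ^ 2 → F x = 0) : 𝓓(Ω, ℝ) where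
  toFun := F
  contDiff' := hF
  hasCompactSupport' := HasCompactSupport.intro (isCompact_closedBall 0 (Real.sqrt c))
    (eq_zero_of_notMem_closedBall h)
  tsupport_subset' := by
    refine (closure_minimal (fun x hx => ?_) Metric.isClosed_closedBall).trans
      (closedBall_sqrt_subset hR hΩ hc)
    by_contra hx'
    exact hx (eq_zero_of_notMem_closedBall h x hx')

theorem integrable_smul_of_eq_zero {E : Type*} [NormedAddCommGroup E] [NormedSpace ℝ E]
    (hR : 0 < R) (hΩ : Metric.ball (0 : Euc N) R ⊆ Ω) (hc : c < R ^ 2)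
    {u : Euc N → ℝ} {g : Euc N → E} (hu : LocallyIntegrableOn u (Ω : Set (Euc N)))
    (hg : Continuous g) (h : ∀ x, c < ‖x‖ ^ 2 → g x = 0) :
    Integrable (fun x => u x • g x) := by
  have h1 : IntegrableOn u (Metric.closedBall (0 : Euc N) (Real.sqrt c)) :=
    hu.integrableOn_compact_subset (closedBall_sqrt_subset hR hΩ hc) (isCompact_closedBall _ _)
  have h2 := h1.smul_continuousOn hg.continuousOn (isCompact_closedBall _ _)
  refine (integrableOn_iff_integrable_of_support_subset fun x hx => ?_).1 h2
  by_contra hx'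
  exact hx (by simp [eq_zero_of_notMem_closedBall h x hx'])

theorem integrable_smul_of_eq_zero' {E : Type*} [NormedAddCommGroup E] [NormedSpace ℝ E]
    (hR : 0 < R) (hΩ : Metric.ball (0 : Euc N) R ⊆ Ω) (hc : c < R ^ 2)
    {g : Euc N → ℝ} {G : Euc N → E} (hG : LocallyIntegrableOn G (Ω : Set (Euc N)))
    (hg : Continuous g) (h : ∀ x, c < ‖x‖ ^ 2 → g x = 0) :
    Integrable (fun x => g x • G x) := by
  have h1 : IntegrableOn G (Metric.closedBall (0 : Euc N) (Real.sqrt c)) :=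
    hG.integrableOn_compact_subset (closedBall_sqrt_subset hR hΩ hc) (isCompact_closedBall _ _)
  have h2 := h1.continuousOn_smul hg.continuousOn (isCompact_closedBall _ _)
  refine (integrableOn_iff_integrable_of_support_subset fun x hx => ?_).1 h2
  by_contra hx'
  exact hx (by simp [eq_zero_of_notMem_closedBall h x hx'])

theorem hasGradientAt_comp_norm_sq {Ψ : ℝ → ℝ} (hΨ : Differentiable ℝ Ψ) (x : Euc N) :
    HasGradientAt (fun x => Ψ (‖x‖ ^ 2)) ((2 * deriv Ψ (‖x‖ ^ 2)) • x) x := by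
  rw [hasGradientAt_iff_hasFDerivAt]
  have h1 := ((hΨ (‖x‖ ^ 2)).hasDerivAt).comp_hasFDerivAt x
    (hasStrictFDerivAt_norm_sq x).hasFDerivAt
  refine h1.congr_fderiv ?_
  ext y
  simp
  ring

theorem hasGradientAt_comp_norm_sq_mul_coord {Θ : ℝ → ℝ} (hΘ : Differentiable ℝ Θ) (i : Fin N)
    (x : Euc N) :
    HasGradientAt (fun x : Euc N => Θ (‖x‖ ^ 2) * x i)
      (Θ (‖x‖ ^ 2) • EuclideanSpace.single i (1 : ℝ) + (2 * deriv Θ (‖x‖ ^ 2) * x i) • x) x := by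
  rw [hasGradientAt_iff_hasFDerivAt]
  have h1 := ((hΘ (‖x‖ ^ 2)).hasDerivAt).comp_hasFDerivAt x
    (hasStrictFDerivAt_norm_sq x).hasFDerivAt
  have h2 : HasFDerivAt (fun x : Euc N => x i) (EuclideanSpace.proj i : Euc N →L[ℝ] ℝ) x :=
    (EuclideanSpace.proj i : Euc N →L[ℝ] ℝ).hasFDerivAt
  refine (h1.mul h2).congr_fderiv ?_
  ext y
  simp [EuclideanSpace.inner_single_left]
  ring

/-- The weak gradient tested against a radial test function. -/
theorem integral_inner_gradient_radial (hR : 0 < R) (hΩ : Metric.ball (0 : Euc N) R ⊆ Ω)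
    (hc : c < R ^ 2) {u : Euc N → ℝ} {G : Euc N → Euc N} (hu : IsWeakGradient Ω u G)
    {Ψ : ℝ → ℝ} (hΨ : ContDiff ℝ ∞ Ψ) (h : ∀ ρ, c < ρ → Ψ ρ = 0) :
    ∫ x in (Ω : Set (Euc N)), inner ℝ (G x) (gradient (fun x : Euc N => Ψ (‖x‖ ^ 2)) x) =
      -∫ x in (Ω : Set (Euc N)), u x * (2 * N * deriv Ψ (‖x‖ ^ 2) +
        4 * ‖x‖ ^ 2 * deriv (deriv Ψ) (‖x‖ ^ 2)) := by
  have hΨ' : ContDiff ℝ ∞ (deriv Ψ) := (contDiff_infty_iff_deriv.1 hΨ).2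
  have hΨ'' : ContDiff ℝ ∞ (deriv (deriv Ψ)) := (contDiff_infty_iff_deriv.1 hΨ').2
  have hz : ∀ {f : ℝ → ℝ}, (∀ ρ, c < ρ → f ρ = 0) → ∀ ρ, c < ρ → deriv f ρ = 0 := by
    intro f hf ρ hρ
    have : f =ᶠ[𝓝 ρ] fun _ => 0 := by
      filter_upwards [Ioi_mem_nhds hρ] with x hx using hf x hx
    rw [this.deriv_eq, deriv_const]
  -- `Θ (|x|²) x i` is the `i`-th component of the gradient of `Ψ (|x|²)`. Each is used as a test
  -- function for the weak gradient, and the sum over `i` produces the Laplacian.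
  set Θ : ℝ → ℝ := fun ρ => 2 * deriv Ψ ρ with hΘdef
  have hΘ : ContDiff ℝ ∞ Θ := contDiff_const.mul hΨ'
  have hΘ0 : ∀ ρ, c < ρ → Θ ρ = 0 := fun ρ hρ => by simp [hΘdef, hz h ρ hρ]
  have hΘ' : ∀ ρ, deriv Θ ρ = 2 * deriv (deriv Ψ) ρ := fun ρ => by
    simp only [hΘdef]
    rw [deriv_const_mul_field]
  have hΘ'0 := hz hΘ0
  have hΘ'c : Continuous (deriv Θ) := (contDiff_infty_iff_deriv.1 hΘ).2.continuous
  have hcoord : ∀ i : Fin N, ContDiff ℝ ∞ (fun x : Euc N => Θ (‖x‖ ^ 2) * x i) := fun i =>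
    (hΘ.comp (contDiff_norm_sq ℝ)).mul (EuclideanSpace.proj i : Euc N →L[ℝ] ℝ).contDiff
  have hcoord0 : ∀ i : Fin N, ∀ x : Euc N, c < ‖x‖ ^ 2 → Θ (‖x‖ ^ 2) * x i = 0 :=
    fun i x hx => by simp [hΘ0 _ hx]
  have hgrad : ∀ i : Fin N, gradient (fun x : Euc N => Θ (‖x‖ ^ 2) * x i) = fun x =>
      Θ (‖x‖ ^ 2) • EuclideanSpace.single i (1 : ℝ) + (2 * deriv Θ (‖x‖ ^ 2) * x i) • x :=
    fun i => gradient_eq fun x =>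
      hasGradientAt_comp_norm_sq_mul_coord (hΘ.differentiable (by simp)) i x
  have hI1 : ∀ i : Fin N, Integrable (fun x : Euc N => (Θ (‖x‖ ^ 2) * x i) • G x) := fun i =>
    integrable_smul_of_eq_zero' hR hΩ hc hu.locInt_grad (hcoord i).continuous (hcoord0 i)
  have hI2 : ∀ i : Fin N, Integrable (fun x : Euc N => u x •
      (Θ (‖x‖ ^ 2) • EuclideanSpace.single i (1 : ℝ) + (2 * deriv Θ (‖x‖ ^ 2) * x i) • x)) :=
    fun i => integrable_smul_of_eq_zero hR hΩ hc hu.locInt (by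
        have := hΘ.continuous
        fun_prop) fun x hx => by
      simp [hΘ0 _ hx, hΘ'0 _ hx]
  have key : ∀ i : Fin N,
      ∫ x in (Ω : Set (Euc N)), u x * (Θ (‖x‖ ^ 2) + 2 * deriv Θ (‖x‖ ^ 2) * x i * x i) =
        -∫ x in (Ω : Set (Euc N)), Θ (‖x‖ ^ 2) * x i * G x i := by
    intro i
    have h1 := hu.integral_eq (ballTest hR hΩ hc _ (hcoord i) (hcoord0 i))
    have e : ((ballTest hR hΩ hc _ (hcoord i) (hcoord0 i) : 𝓓(Ω, ℝ)) : Euc N → ℝ) =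
      fun x : Euc N => Θ (‖x‖ ^ 2) * x i := rfl
    rw [e, hgrad] at h1
    have h2 := congrArg (EuclideanSpace.proj i : Euc N →L[ℝ] ℝ) h1
    rw [map_neg, ← ContinuousLinearMap.integral_comp_comm _ (hI1 i).integrableOn,
      ← ContinuousLinearMap.integral_comp_comm _ (hI2 i).integrableOn] at h2
    simpa [mul_add] using h2
  have hgradΨ : ∀ x, gradient (fun x : Euc N => Ψ (‖x‖ ^ 2)) x = (2 * deriv Ψ (‖x‖ ^ 2)) • x :=
    fun x => (hasGradientAt_comp_norm_sq (hΨ.differentiable (by simp)) x).gradient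
  have eL : ∀ x : Euc N, inner ℝ (G x) (gradient (fun x : Euc N => Ψ (‖x‖ ^ 2)) x) =
      ∑ i, Θ (‖x‖ ^ 2) * x i * G x i := by
    intro x
    rw [hgradΨ, PiLp.inner_apply]
    refine Finset.sum_congr rfl fun i _ => ?_
    simp [hΘdef]
  have eR : ∀ x : Euc N, u x * (2 * N * deriv Ψ (‖x‖ ^ 2) +
      4 * ‖x‖ ^ 2 * deriv (deriv Ψ) (‖x‖ ^ 2)) =
      ∑ i : Fin N, u x * (Θ (‖x‖ ^ 2) + 2 * deriv Θ (‖x‖ ^ 2) * x i * x i) := by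
    intro x
    have hn : ‖x‖ ^ 2 = ∑ i, x i * x i := by
      rw [EuclideanSpace.real_norm_sq_eq]
      exact Finset.sum_congr rfl fun i _ => by ring
    rw [← Finset.mul_sum, Finset.sum_add_distrib]
    simp only [mul_assoc, ← Finset.mul_sum, ← hn]
    simp [hΘ']
    simp only [hΘdef]
    left
    ring
  simp only [eL, eR]
  rw [integral_finsetSum, integral_finsetSum, ← Finset.sum_neg_distrib]
  · exact Finset.sum_congr rfl fun i _ => by rw [key i, neg_neg]
  · intro i _
    have := ((EuclideanSpace.proj i : Euc N →L[ℝ] ℝ).integrable_comp (hI2 i)).integrableOn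
      (s := (Ω : Set (Euc N)))
    simpa [mul_add] using! this
  · intro i _
    have := ((EuclideanSpace.proj i : Euc N →L[ℝ] ℝ).integrable_comp (hI1 i)).integrableOn
      (s := (Ω : Set (Euc N)))
    simpa using! this

end WeakGradient

/-! ### Polar coordinates in the variable `s = r ^ (-α)`. -/

section RadialIntegral

variable {N : ℕ} {α : ℝ}

theorem rpow_radial_weight (hN : 1 ≤ N) {s : ℝ} (hs : 0 < s) :
    s ^ (-(1 / α) - 1) * (s ^ (-(1 / α))) ^ (N - 1) = s ^ (-(N / α) - 1) := by
  rw [← Real.rpow_natCast, ← Real.rpow_mul hs.le, ← Real.rpow_add hs]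
  congr 1
  push_cast [hN]
  ring

theorem integrable_radial_iff (hN : 1 ≤ N) (hα : 0 < α) (g : ℝ → ℝ) :
    Integrable (fun x : Euc N => g ‖x‖) ↔
      IntegrableOn (fun s => s ^ (-(N / α) - 1) * g (s ^ (-(1 / α)))) (Ioi 0) := by
  have : Nontrivial (Euc N) := by
    have : Nonempty (Fin N) := ⟨⟨0, hN⟩⟩
    infer_instance
  rw [integrable_fun_norm_addHaar, ← integrableOn_Ioi_comp_rpow_iff' (p := -(1 / α)) _
    (by simp; exact hα.ne'), finrank_euclideanSpace_fin]
  refine integrableOn_congr_fun (fun s hs => ?_) measurableSet_Ioi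
  simp only [smul_eq_mul]
  rw [← mul_assoc, rpow_radial_weight hN hs]

/-- A single `C` serves every `g`, so it cancels between the two sides of the weak equation. -/
theorem exists_integral_radial_eq (hN : 1 ≤ N) (hα : 0 < α) : ∃ C : ℝ, 0 < C ∧ ∀ g : ℝ → ℝ,
    ∫ x : Euc N, g ‖x‖ = C * ∫ s in Ioi 0, s ^ (-(N / α) - 1) * g (s ^ (-(1 / α))) := by
  have : Nontrivial (Euc N) := by
    have : Nonempty (Fin N) := ⟨⟨0, hN⟩⟩
    infer_instance
  refine ⟨N * (volume.real (Metric.ball (0 : Euc N) 1) * (1 / α)), ?_, fun g => ?_⟩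
  · have h1 : 0 < volume.real (Metric.ball (0 : Euc N) 1) :=
      ENNReal.toReal_pos (Metric.measure_ball_pos _ _ one_pos).ne' measure_ball_lt_top.ne
    have h2 : (0 : ℝ) < N := by exact_mod_cast hN
    positivity
  · rw [integral_fun_norm_addHaar, ← integral_comp_rpow_Ioi (p := -(1 / α)) _
      (by simp; exact hα.ne'), finrank_euclideanSpace_fin, nsmul_eq_mul, smul_eq_mul, mul_assoc,
      mul_assoc]
    congr 2
    rw [← integral_const_mul]
    refine setIntegral_congr_fun measurableSet_Ioi fun s hs => ?_
    simp only [smul_eq_mul]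
    rw [← rpow_radial_weight hN hs, abs_neg, abs_of_pos (by positivity)]
    ring

end RadialIntegral

/-! ### Reduction of the weak equation to the ODE. -/

section Profile

variable {N : ℕ} {Ω : Opens (Euc N)} {α ν p q R μ : ℝ} {u : Euc N → ℝ} {f : ℝ → ℝ}

/-- The Emden-Fowler profile `w` of `f`: if `s = r ^ (-α)`, then `f r = r ^ (-ν) w s`. -/
noncomputable def profile (α ν : ℝ) (f : ℝ → ℝ) (s : ℝ) : ℝ :=
  s ^ (-(ν / α)) * f (s ^ (-(1 / α)))

theorem rpow_neg_rpow_neg_inv (hα : 0 < α) {s : ℝ} (hs : 0 < s) :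
    (s ^ (-(1 / α))) ^ (-α) = s := by
  rw [← Real.rpow_mul hs.le]
  have : -(1 / α) * -α = 1 := by field_simp
  rw [this, Real.rpow_one]

theorem rpow_neg_inv_rpow_neg (hα : 0 < α) {r : ℝ} (hr : 0 < r) :
    (r ^ (-α)) ^ (-(1 / α)) = r := by
  rw [← Real.rpow_mul hr.le]
  have : -α * -(1 / α) = 1 := by field_simp
  rw [this, Real.rpow_one]

theorem profile_nonneg (hf : ∀ r, 0 ≤ f r) {s : ℝ} (hs : 0 < s) : 0 ≤ profile α ν f s :=
  mul_nonneg (Real.rpow_nonneg hs.le _) (hf _)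

theorem profile_rpow_neg (hα : 0 < α) {r : ℝ} (hr : 0 < r) :
    profile α ν f (r ^ (-α)) = r ^ ν * f r := by
  rw [profile, rpow_neg_inv_rpow_neg hα hr, ← Real.rpow_mul hr.le]
  congr 2
  field_simp

theorem rpow_neg_inv_lt (hα : 0 < α) (hR : 0 < R) {s : ℝ} (hs : R ^ (-α) < s) :
    s ^ (-(1 / α)) < R := by
  have h1 := Real.rpow_lt_rpow_of_neg (z := -(1 / α)) (by positivity) hs (by simpa using hα)
  rwa [rpow_neg_inv_rpow_neg hα hR] at h1

/-- A ball has finite measure, so `L ^ (q + 1)` is contained in `L ^ e` there; the weight is the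
radial Jacobian times the power of `s` lost in passing from `f` to its profile. -/
theorem integrableOn_profile_rpow (hN : 1 ≤ N) (hα : 0 < α) (hR : 0 < R)
    (hΩ : Metric.ball (0 : Euc N) R ⊆ Ω) (hf : ∀ r, 0 ≤ f r)
    (hu : ∀ᵐ x ∂volume.restrict (Ω : Set (Euc N)), u x = f ‖x‖)
    (hmem : MemLp u (ENNReal.ofReal (q + 1)) (volume.restrict (Ω : Set (Euc N))))
    {e : ℝ} (he : 0 < e) (heq : e ≤ q + 1) :
    IntegrableOn (fun s => s ^ (-(N / α) - 1 + e * ν / α) * profile α ν f s ^ e)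
      (Ioi (R ^ (-α))) := by
  have : IsFiniteMeasure (volume.restrict (Metric.ball (0 : Euc N) R)) :=
    ⟨by simpa using measure_ball_lt_top⟩
  have h1 : MemLp u (ENNReal.ofReal e) (volume.restrict (Metric.ball (0 : Euc N) R)) :=
    (hmem.mono_measure (Measure.restrict_mono hΩ le_rfl)).mono_exponent
      (ENNReal.ofReal_le_ofReal heq)
  have h2 := h1.integrable_norm_rpow (by simpa using he) (by simp)
  rw [ENNReal.toReal_ofReal he.le] at h2
  have h3 : IntegrableOn (fun x : Euc N => f ‖x‖ ^ e) (Metric.ball (0 : Euc N) R) := by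
    refine h2.congr ?_
    filter_upwards [ae_restrict_of_ae_restrict_of_subset hΩ hu] with x hx
    rw [hx, Real.norm_of_nonneg (hf _)]
  have h4 : Integrable (fun x : Euc N => (Iio R).indicator (fun r => f r ^ e) ‖x‖) := by
    rw [← integrable_indicator_iff measurableSet_ball] at h3
    refine h3.congr (ae_of_all _ fun x => ?_)
    simp [indicator]
  rw [integrable_radial_iff hN hα] at h4
  have hRα : 0 < R ^ (-α) := by positivity
  refine (h4.mono_set (Ioi_subset_Ioi hRα.le)).congr_fun (fun s hs => ?_) measurableSet_Ioi
  have hs0 : 0 < s := hRα.trans hs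
  simp only
  rw [indicator_of_mem (mem_Iio.2 (rpow_neg_inv_lt hα hR hs)), profile,
    Real.mul_rpow (Real.rpow_nonneg hs0.le _) (hf _), ← Real.rpow_mul hs0.le, ← mul_assoc,
    ← Real.rpow_add hs0]
  congr 2
  ring

theorem locallyIntegrableOn_profile_rpow (hN : 1 ≤ N) (hα : 0 < α) (hR : 0 < R)
    (hΩ : Metric.ball (0 : Euc N) R ⊆ Ω) (hf : ∀ r, 0 ≤ f r)
    (hu : ∀ᵐ x ∂volume.restrict (Ω : Set (Euc N)), u x = f ‖x‖)
    (hmem : MemLp u (ENNReal.ofReal (q + 1)) (volume.restrict (Ω : Set (Euc N))))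
    {e : ℝ} (he : 0 < e) (heq : e ≤ q + 1) :
    LocallyIntegrableOn (fun s => profile α ν f s ^ e) (Ioi (R ^ (-α))) := by
  have h1 := (integrableOn_profile_rpow (ν := ν) hN hα hR hΩ hf hu hmem he heq).locallyIntegrableOn
  have hpos : ∀ s ∈ Ioi (R ^ (-α)), 0 < s := fun s hs =>
    (Real.rpow_pos_of_pos hR (-α)).trans hs
  have h2 : ContinuousOn (fun s : ℝ => s ^ (-(-(N / α) - 1 + e * ν / α))) (Ioi (R ^ (-α))) :=
    fun s hs => (Real.continuousAt_rpow_const _ _ (Or.inl (hpos s hs).ne')).continuousWithinAt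
  refine (h1.continuousOn_mul h2 isOpen_Ioi.isLocallyClosed).congr ?_
  filter_upwards [ae_restrict_mem measurableSet_Ioi] with s hs
  rw [← mul_assoc, ← Real.rpow_add (hpos s hs), neg_add_cancel, Real.rpow_zero, one_mul]

theorem setIntegral_radial_eq (hR : 0 < R) (hΩ : Metric.ball (0 : Euc N) R ⊆ Ω)
    (hu : ∀ᵐ x ∂volume.restrict (Ω : Set (Euc N)), u x = f ‖x‖) (F K : ℝ → ℝ)
    (hK : ∀ ρ, R ^ 2 ≤ ρ → K ρ = 0) :
    ∫ x in (Ω : Set (Euc N)), F (u x) * K (‖x‖ ^ 2) = ∫ x : Euc N, F (f ‖x‖) * K (‖x‖ ^ 2) := by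
  have h1 : ∫ x in (Ω : Set (Euc N)), F (u x) * K (‖x‖ ^ 2) =
      ∫ x in (Ω : Set (Euc N)), F (f ‖x‖) * K (‖x‖ ^ 2) := by
    refine integral_congr_ae ?_
    filter_upwards [hu] with x hx
    rw [hx]
  rw [h1, setIntegral_eq_integral_of_forall_compl_eq_zero]
  intro x hx
  have h2 : R ≤ ‖x‖ := by
    by_contra! h
    exact hx (hΩ (mem_ball_zero_iff.2 h))
  rw [hK _ (pow_le_pow_left₀ hR.le h2 2), mul_zero]

theorem sq_rpow_neg_inv {s : ℝ} (hs : 0 < s) :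
    (s ^ (-(1 / α))) ^ 2 = s ^ (-(2 / α)) := by
  rw [← Real.rpow_natCast, ← Real.rpow_mul hs.le]
  congr 1
  push_cast
  ring

/-- The radial profile of a weak solution solves the Emden-Fowler equation in the sense of
distributions. -/
theorem integral_profile_mul_deriv_deriv (hN : 1 ≤ N) (hα0 : 0 < α) (hα : α = N - 2 - 2 * ν)
    (hν : ν ^ 2 - (N - 2) * ν + μ = 0) (hq : ν * q = 2 + ν)
    (hR : 0 < R) (hΩ : Metric.ball (0 : Euc N) R ⊆ Ω) (hf : ∀ r, 0 ≤ f r)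
    (hu : ∀ᵐ x ∂volume.restrict (Ω : Set (Euc N)), u x = f ‖x‖) (hsol : IsSolution Ω μ p q u)
    {χ : ℝ → ℝ} (hχ : IsTest (R ^ (-α)) χ) :
    ∫ s, profile α ν f s * deriv (deriv χ) s =
      ∫ s, 1 / α ^ 2 * (profile α ν f s ^ q - s ^ (-(ν * (q - p) / α)) * profile α ν f s ^ p) /
        s ^ 2 * χ s := by
  obtain ⟨-, -, G, hG, heq⟩ := hsol
  have hRα : 0 < R ^ (-α) := by positivity
  obtain ⟨b, c, hb, hc, hz⟩ := exists_powerTest_eq_zero (ν := ν) hRα hα0 hχ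
  have hcR : c < R ^ 2 := by
    have : (R ^ (-α)) ^ (-(2 / α)) = R ^ 2 := by
      rw [← Real.rpow_mul hR.le, ← Real.rpow_natCast]
      congr 1
      field_simp
      norm_num
    rwa [this] at hc
  set Ψ := powerTest α ν χ with hΨdef
  have hΨ : ContDiff ℝ ∞ Ψ := contDiff_powerTest hRα hα0 hχ
  have hΨ' : ContDiff ℝ ∞ (deriv Ψ) := (contDiff_infty_iff_deriv.1 hΨ).2
  have hΨ'' : ContDiff ℝ ∞ (deriv (deriv Ψ)) := (contDiff_infty_iff_deriv.1 hΨ').2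
  have hΨ0 : ∀ ρ, c < ρ → Ψ ρ = 0 := fun ρ hρ => hz ρ fun h => absurd h.2 (not_le.2 hρ)
  have hd0 : ∀ {g : ℝ → ℝ}, (∀ ρ, c < ρ → g ρ = 0) → ∀ ρ, c < ρ → deriv g ρ = 0 := by
    intro g hg ρ hρ
    have : g =ᶠ[𝓝 ρ] fun _ => 0 := by
      filter_upwards [Ioi_mem_nhds hρ] with x hx using hg x hx
    rw [this.deriv_eq, deriv_const]
  have hdivc : Continuous fun ρ => Ψ ρ / ρ := by
    rw [continuous_iff_continuousAt]
    intro ρ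
    rcases eq_or_ne ρ 0 with h0 | h0
    · refine continuousAt_const.congr (f := fun _ => (0 : ℝ)) ?_
      filter_upwards [Iio_mem_nhds (h0.trans_lt hb)] with x hx
      rw [hz x fun h => absurd h.1 (not_le.2 hx), zero_div]
    · exact hΨ.continuous.continuousAt.div continuousAt_id h0
  -- `K (|x|²)` is `Δ + μ / |x|²` applied to the test function, so that `u` itself is paired with
  -- it.
  set K : ℝ → ℝ := fun ρ =>
    2 * N * deriv Ψ ρ + 4 * ρ * deriv (deriv Ψ) ρ + μ * (Ψ ρ / ρ) with hKdef
  have hK0 : ∀ ρ, c < ρ → K ρ = 0 := fun ρ hρ => by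
    simp [hKdef, hΨ0 ρ hρ, hd0 hΨ0 ρ hρ, hd0 (hd0 hΨ0) ρ hρ]
  have hsmooth : ContDiff ℝ ∞ fun x : Euc N => Ψ (‖x‖ ^ 2) := hΨ.comp (contDiff_norm_sq ℝ)
  have h1 := heq (ballTest hR hΩ hcR _ hsmooth fun x hx => hΨ0 _ hx)
  have e : ((ballTest hR hΩ hcR _ hsmooth fun x hx => hΨ0 _ hx : 𝓓(Ω, ℝ)) : Euc N → ℝ) =
    fun x : Euc N => Ψ (‖x‖ ^ 2) := rfl
  rw [e, integral_inner_gradient_radial hR hΩ hcR hG.weakGradient hΨ hΨ0] at h1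
  have hI1 : Integrable fun x : Euc N => u x • (2 * N * deriv Ψ (‖x‖ ^ 2) +
      4 * ‖x‖ ^ 2 * deriv (deriv Ψ) (‖x‖ ^ 2)) :=
    integrable_smul_of_eq_zero hR hΩ hcR hG.weakGradient.locInt (by
      have := hΨ'.continuous
      have := hΨ''.continuous
      fun_prop) fun x hx => by simp [hd0 hΨ0 _ hx, hd0 (hd0 hΨ0) _ hx]
  have hI2 : Integrable fun x : Euc N => u x • (Ψ (‖x‖ ^ 2) / ‖x‖ ^ 2) :=
    integrable_smul_of_eq_zero hR hΩ hcR hG.weakGradient.locInt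
      (hdivc.comp (f := fun x : Euc N => ‖x‖ ^ 2) (by fun_prop)) fun x hx => by simp [hΨ0 _ hx]
  have h2 : -∫ x in (Ω : Set (Euc N)), u x * K (‖x‖ ^ 2) =
      ∫ x in (Ω : Set (Euc N)), (u x ^ p - u x ^ q) * Ψ (‖x‖ ^ 2) := by
    have e1 : ∀ x : Euc N, u x * K (‖x‖ ^ 2) = u x • (2 * N * deriv Ψ (‖x‖ ^ 2) +
        4 * ‖x‖ ^ 2 * deriv (deriv Ψ) (‖x‖ ^ 2)) + μ * (u x • (Ψ (‖x‖ ^ 2) / ‖x‖ ^ 2)) := by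
      intro x
      simp only [hKdef, smul_eq_mul]
      ring
    simp only [e1]
    rw [integral_add hI1.integrableOn (hI2.integrableOn.const_mul μ), integral_const_mul]
    simp only [smul_eq_mul, ← mul_div_assoc]
    rw [← h1]
    ring
  rw [setIntegral_radial_eq hR hΩ hu (fun t => t) K fun ρ hρ => hK0 ρ (hcR.trans_le hρ),
    setIntegral_radial_eq hR hΩ hu (fun t => t ^ p - t ^ q) Ψ
      fun ρ hρ => hΨ0 ρ (hcR.trans_le hρ)] at h2
  obtain ⟨C, hC, hint⟩ := exists_integral_radial_eq hN hα0
  rw [hint fun r => f r * K (r ^ 2), hint fun r => (f r ^ p - f r ^ q) * Ψ (r ^ 2)] at h2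
  have hχ0 : ∀ s, s ∉ Ioi (0 : ℝ) → χ s = 0 := fun s hs =>
    image_eq_zero_of_notMem_tsupport fun h => hs (hRα.trans (hχ.supp h))
  have hχ''0 : ∀ s, s ∉ Ioi (0 : ℝ) → deriv (deriv χ) s = 0 := fun s hs =>
    image_eq_zero_of_notMem_tsupport fun h => hs (hRα.trans (hχ.deriv.deriv.supp h))
  have hαN : (N : ℝ) = α + 2 + 2 * ν := by rw [hα]; ring
  have eL : ∫ s in Ioi 0, s ^ (-(N / α) - 1) * (f (s ^ (-(1 / α))) * K ((s ^ (-(1 / α))) ^ 2)) =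
      α ^ 2 * ∫ s, profile α ν f s * deriv (deriv χ) s := by
    rw [← setIntegral_eq_integral_of_forall_compl_eq_zero (s := Ioi (0 : ℝ))
      (f := fun s => profile α ν f s * deriv (deriv χ) s) (fun s hs => by rw [hχ''0 s hs, mul_zero]), ← integral_const_mul]
    refine setIntegral_congr_fun measurableSet_Ioi fun s hs => ?_
    have hs0 : (0 : ℝ) < s := hs
    have hρ : 0 < s ^ (-(2 / α)) := by positivity
    rw [sq_rpow_neg_inv hs0]
    simp only [hKdef]
    rw [hardy_powerTest hχ.smooth hα hν hρ, ← Real.rpow_mul hs0.le, ← Real.rpow_mul hs0.le, profile]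
    have e1 : -(2 / α) * -(α / 2) = 1 := by field_simp
    have e2 : s ^ (-(ν / α)) = s ^ (-(N / α) - 1) * s ^ (-(2 / α) * (-(ν / 2) - α - 1)) := by
      rw [← Real.rpow_add hs0, hαN]
      congr 1
      field_simp
      ring
    rw [e1, Real.rpow_one, e2]
    ring
  have eR : ∫ s in Ioi 0, s ^ (-(N / α) - 1) *
      ((f (s ^ (-(1 / α))) ^ p - f (s ^ (-(1 / α))) ^ q) * Ψ ((s ^ (-(1 / α))) ^ 2)) =
      -α ^ 2 * ∫ s, 1 / α ^ 2 *
        (profile α ν f s ^ q - s ^ (-(ν * (q - p) / α)) * profile α ν f s ^ p) / s ^ 2 * χ s := by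
    rw [← setIntegral_eq_integral_of_forall_compl_eq_zero (s := Ioi (0 : ℝ))
      (f := fun s => 1 / α ^ 2 *
        (profile α ν f s ^ q - s ^ (-(ν * (q - p) / α)) * profile α ν f s ^ p) / s ^ 2 * χ s)
      (fun s hs => by rw [hχ0 s hs, mul_zero]), ← integral_const_mul]
    refine setIntegral_congr_fun measurableSet_Ioi fun s hs => ?_
    have hs0 : (0 : ℝ) < s := hs
    have hρ : 0 < s ^ (-(2 / α)) := by positivity
    rw [sq_rpow_neg_inv hs0, hΨdef, powerTest_of_pos hρ, ← Real.rpow_mul hs0.le,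
      ← Real.rpow_mul hs0.le, profile, Real.mul_rpow (by positivity) (hf _),
      Real.mul_rpow (by positivity) (hf _), ← Real.rpow_mul hs0.le, ← Real.rpow_mul hs0.le]
    have e1 : -(2 / α) * -(α / 2) = 1 := by field_simp
    -- Here `ν q = 2 + ν` enters: the `w ^ q` term gets the exact weight `s ^ (-2)`, while `w ^ p`
    -- keeps the extra decay `s ^ (-κ)`.
    have e2 : s ^ (-(N / α) - 1) * s ^ (-(2 / α) * -(ν / 2)) = s ^ (-(ν / α) * q) / s ^ 2 := by
      rw [← Real.rpow_natCast, ← Real.rpow_add hs0, ← Real.rpow_sub hs0, hαN]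
      congr 1
      push_cast
      field_simp
      linear_combination hq
    have e3 : s ^ (-(ν * (q - p) / α)) * s ^ (-(ν / α) * p) = s ^ (-(ν / α) * q) := by
      rw [← Real.rpow_add hs0]
      congr 1
      field_simp
      ring
    rw [e1, Real.rpow_one, ← mul_assoc (s ^ (-(ν * (q - p) / α))), e3]
    have hα2 : α ^ 2 ≠ 0 := by positivity
    calc _ = (s ^ (-(N / α) - 1) * s ^ (-(2 / α) * -(ν / 2))) *
          (f (s ^ (-(1 / α))) ^ p - f (s ^ (-(1 / α))) ^ q) * χ s := by ring
      _ = _ := by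
        rw [e2]
        field_simp
        ring
  rw [eL, eR] at h2
  have hCα : C * α ^ 2 ≠ 0 := by positivity
  refine mul_left_cancel₀ hCα ?_
  linarith

/-- A null set of radial parameters corresponds to a null set in space. -/
theorem ae_radial_of_ae (hN : 1 ≤ N) (hα : 0 < α) {P : ℝ → Prop} (hP : ∀ᵐ s, P s) :
    ∀ᵐ x : Euc N, x ≠ 0 → P (‖x‖ ^ (-α)) := by
  obtain ⟨C, hC, hint⟩ := exists_integral_radial_eq hN hα
  -- `P` need not be measurable, so a measurable null hull is transported, through the integral of
  -- its indicator.
  set S := toMeasurable volume {s | ¬ P s}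
  have hS : volume S = 0 := by rw [measure_toMeasurable]; exact ae_iff.1 hP
  set g : ℝ → ℝ := fun r => S.indicator (fun _ => 1) (r ^ (-α))
  have hae : (fun s => s ^ (-(N / α) - 1) * g (s ^ (-(1 / α)))) =ᵐ[volume.restrict (Ioi 0)] 0 := by
    filter_upwards [ae_restrict_mem measurableSet_Ioi,
      ae_restrict_of_ae (measure_eq_zero_iff_ae_notMem.1 hS)] with s hs hsS
    simp only [g]
    rw [rpow_neg_rpow_neg_inv hα hs, indicator_of_notMem hsS, mul_zero, Pi.zero_apply]
  have h1 : Integrable fun x : Euc N => g ‖x‖ := by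
    rw [integrable_radial_iff hN hα]
    exact (integrable_zero _ _ _).congr hae.symm
  have h2 : ∫ x : Euc N, g ‖x‖ = 0 := by
    rw [hint, integral_congr_ae hae]
    simp
  have h3 := (integral_eq_zero_iff_of_nonneg
    (fun x => indicator_nonneg (fun _ _ => zero_le_one) _) h1).1 h2
  filter_upwards [h3] with x hx _
  by_contra hPx
  have h4 : ‖x‖ ^ (-α) ∈ S := subset_toMeasurable _ _ hPx
  simp [h4] at hx

end Profile

theorem exists_emden_profile {N : ℕ} {Ω : Opens (Euc N)} {α ν p q R μ : ℝ}
    {u : Euc N → ℝ} {f : ℝ → ℝ} (hN : 1 ≤ N) (hα0 : 0 < α) (hα : α = N - 2 - 2 * ν)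
    (hν : ν ^ 2 - (N - 2) * ν + μ = 0) (hq : ν * q = 2 + ν) (hp0 : 0 < p) (hpq : p < q)
    (hR : 0 < R) (hΩ : Metric.ball (0 : Euc N) R ⊆ Ω) (hf : ∀ r, 0 ≤ f r)
    (hu : ∀ᵐ x ∂volume.restrict (Ω : Set (Euc N)), u x = f ‖x‖) (hsol : IsSolution Ω μ p q u) :
    ∃ w w₁, IsEmdenSolution (R ^ (-α)) (1 / α ^ 2) (ν * (q - p) / α) p q w w₁ ∧
      IntegrableOn (fun s => w s ^ (q + 1) / s ^ 2) (Ioi (R ^ (-α))) ∧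
      ∀ᵐ x : Euc N, x ≠ 0 → ‖x‖ < R → f ‖x‖ = ‖x‖ ^ (-ν) * w (‖x‖ ^ (-α)) := by
  have hRα : 0 < R ^ (-α) := by positivity
  have hq0 : 0 < q := hp0.trans hpq
  have hmem := hsol.2.1
  have hloc : ∀ e, 0 < e → e ≤ q + 1 →
      LocallyIntegrableOn (fun s => profile α ν f s ^ e) (Ioi (R ^ (-α))) := fun e he heq =>
    locallyIntegrableOn_profile_rpow hN hα0 hR hΩ hf hu hmem he heq
  have hpos : ∀ s ∈ Ioi (R ^ (-α)), s ≠ 0 := fun s hs => (hRα.trans hs).ne'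
  have hw : LocallyIntegrableOn (profile α ν f) (Ioi (R ^ (-α))) := by
    simpa using hloc 1 one_pos (by linarith)
  have hh : LocallyIntegrableOn (fun s => 1 / α ^ 2 * (profile α ν f s ^ q -
      s ^ (-(ν * (q - p) / α)) * profile α ν f s ^ p) / s ^ 2) (Ioi (R ^ (-α))) := by
    have hc1 : ContinuousOn (fun s : ℝ => s ^ (-(ν * (q - p) / α))) (Ioi (R ^ (-α))) := fun s hs =>
      (Real.continuousAt_rpow_const _ _ (Or.inl (hpos s hs))).continuousWithinAt
    have hc2 : ContinuousOn (fun s : ℝ => 1 / α ^ 2 / s ^ 2) (Ioi (R ^ (-α))) :=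
      continuousOn_const.div (by fun_prop) fun s hs => pow_ne_zero 2 (hpos s hs)
    have h1 := ((hloc q hq0 (by linarith)).sub ((hloc p hp0 (by linarith)).continuousOn_mul hc1
      isOpen_Ioi.isLocallyClosed)).continuousOn_mul hc2 isOpen_Ioi.isLocallyClosed
    refine h1.congr (ae_of_all _ fun s => ?_)
    simp only [Pi.sub_apply]
    ring
  obtain ⟨w, w₁, hsolw, hae⟩ := exists_isEmdenSolution hRα.le hp0 hq0 hw hh
    (fun s hs => profile_nonneg hf (hRα.trans hs))
    (fun χ hχ => integral_profile_mul_deriv_deriv hN hα0 hα hν hq hR hΩ hf hu hsol hχ)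
  refine ⟨w, w₁, hsolw, ?_, ?_⟩
  · refine (integrableOn_profile_rpow (ν := ν) hN hα0 hR hΩ hf hu hmem
      (by linarith : 0 < q + 1) le_rfl).congr ?_
    filter_upwards [ae_restrict_mem measurableSet_Ioi, ae_restrict_of_ae hae] with s hs hws
    -- From `(q + 1) ν = 2 + 2ν` and `N = α + 2 + 2ν`.
    have e : -(N / α) - 1 + (q + 1) * ν / α = -(2 : ℕ) := by
      push_cast
      field_simp
      linear_combination hq + hα
    rw [hws hs, e, Real.rpow_neg (hRα.trans hs).le, Real.rpow_natCast, mul_comm, div_eq_mul_inv]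
  · filter_upwards [ae_radial_of_ae hN hα0 hae] with x hx hx0 hxR
    have hxpos : 0 < ‖x‖ := norm_pos_iff.2 hx0
    have hmem' : ‖x‖ ^ (-α) ∈ Ioi (R ^ (-α)) :=
      Real.rpow_lt_rpow_of_neg hxpos hxR (by linarith)
    rw [← hx hx0 hmem', profile_rpow_neg hα0 hxpos, ← mul_assoc, ← Real.rpow_add hxpos]
    simp

/-! ### Return to space. -/

/-- Small punctured balls have positive measure, so positivity almost everywhere yields one positive
value of `w`; that is all the lower barrier needs to start. -/
theorem exists_pos_of_ae_pos {N : ℕ} {Ω : Opens (Euc N)} {α ν b : ℝ} {u : Euc N → ℝ}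
    {w : ℝ → ℝ} (hα : 0 < α) (h0 : (0 : Euc N) ∈ Ω) (hN : 1 ≤ N)
    (hu : ∀ᵐ x ∂volume.restrict (Ω : Set (Euc N)), 0 < u x)
    (huw : ∀ᶠ x in ae (volume.restrict (Ω : Set (Euc N))),
      x ≠ 0 → b < ‖x‖ ^ (-α) → u x = ‖x‖ ^ (-ν) * w (‖x‖ ^ (-α))) :
    ∃ s, b < s ∧ 0 < w s := by
  have hlim : Tendsto (fun x : Euc N => ‖x‖ ^ (-α)) (𝓝[≠] 0) atTop :=
    (tendsto_rpow_neg_nhdsGT_zero (neg_neg_of_pos hα)).comp tendsto_norm_nhdsNE_zero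
  have h1 : ∀ᶠ x in 𝓝[≠] (0 : Euc N), b < ‖x‖ ^ (-α) ∧ x ∈ Ω :=
    (hlim.eventually_gt_atTop b).and (nhdsWithin_le_nhds (Ω.isOpen.mem_nhds h0))
  rw [eventually_nhdsWithin_iff, Metric.eventually_nhds_iff_ball] at h1
  obtain ⟨r, hr, h1⟩ := h1
  have : Nontrivial (Euc N) := by
    have : Nonempty (Fin N) := ⟨⟨0, hN⟩⟩
    infer_instance
  have h2 : ∀ᵐ x ∂volume.restrict (Ω : Set (Euc N)), x ≠ 0 :=
    ae_restrict_of_ae (measure_eq_zero_iff_ae_notMem.1 (measure_singleton (0 : Euc N)))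
  have h3 := (hu.and (huw.and h2))
  rw [ae_restrict_iff' Ω.isOpen.measurableSet] at h3
  have h4 : 0 < volume (Metric.ball (0 : Euc N) r \ {0}) := by
    rw [measure_sdiff_null (measure_singleton _)]
    exact Metric.measure_ball_pos _ _ hr
  obtain ⟨x, hx, hx3⟩ : ∃ x, x ∈ Metric.ball (0 : Euc N) r \ {0} ∧ _ := by
    by_contra! hcon
    exact h4.ne' (measure_mono_null (fun x hx => hcon x hx) (ae_iff.1 h3))
  obtain ⟨hbx, hxΩ⟩ := h1 x hx.1 hx.2
  obtain ⟨hux, huwx, hx0⟩ := hx3 hxΩ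
  refine ⟨_, hbx, ?_⟩
  rw [huwx hx0 hbx] at hux
  exact pos_of_mul_pos_right hux (by positivity)

/-- Change of variables in the logarithmic asymptotics. -/
theorem tendsto_of_tendsto_mul_log {N : ℕ} {α ν c : ℝ} {w : ℝ → ℝ} {v : Euc N → ℝ} (hα : 0 < α)
    (hw : Tendsto (fun s => w s * Real.log s ^ (ν / 2)) atTop (𝓝 c))
    (hv : ∀ᶠ x in 𝓝[≠] (0 : Euc N), v x = ‖x‖ ^ (-ν) * w (‖x‖ ^ (-α))) :
    Tendsto (fun x => v x / (‖x‖ ^ (-ν) * |Real.log ‖x‖| ^ (-(ν / 2)))) (𝓝[≠] (0 : Euc N))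
      (𝓝 (c * α ^ (-(ν / 2)))) := by
  have hlim : Tendsto (fun x : Euc N => ‖x‖ ^ (-α)) (𝓝[≠] 0) atTop :=
    (tendsto_rpow_neg_nhdsGT_zero (neg_neg_of_pos hα)).comp tendsto_norm_nhdsNE_zero
  refine ((hw.comp hlim).mul_const (α ^ (-(ν / 2)))).congr' ?_
  have hlt : ∀ᶠ x in 𝓝[≠] (0 : Euc N), ‖x‖ ∈ Ioo (0 : ℝ) 1 :=
    tendsto_norm_nhdsNE_zero.eventually (Ioo_mem_nhdsGT one_pos)
  filter_upwards [hv, hlt] with x hvx hx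
  have hl : 0 < -Real.log ‖x‖ := neg_pos.2 (Real.log_neg hx.1 hx.2)
  have hx1 := hx.1
  rw [hvx, Function.comp_apply, Real.log_rpow hx.1, abs_of_neg (neg_pos.1 hl),
    show -α * Real.log ‖x‖ = α * -Real.log ‖x‖ by ring, Real.mul_rpow hα.le hl.le,
    Real.rpow_neg hl.le, Real.rpow_neg hα.le]
  have h1 : 0 < ‖x‖ ^ (-ν) := by positivity
  have h2 : 0 < (-Real.log ‖x‖) ^ (ν / 2) := by positivity
  have h3 : 0 < α ^ (ν / 2) := by positivity
  field_simp

theorem nu_pos {N : ℕ} {μ : ℝ} (hμ0 : 0 < μ) (hμ : μ < muBar N) : 0 < nu N μ :=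
  sub_pos.2 (Real.sqrt_lt_sqrt (by linarith) (by linarith))

theorem sqrt_muBar {N : ℕ} (hN : 2 ≤ N) : Real.sqrt (muBar N) = ((N : ℝ) - 2) / 2 := by
  have : (2 : ℝ) ≤ N := by exact_mod_cast hN
  exact Real.sqrt_sq (by linarith)

theorem alpha_pos {N : ℕ} {μ : ℝ} (hN : 2 ≤ N) (hμ : μ < muBar N) : 0 < alpha N μ := by
  have h1 : 0 < Real.sqrt (muBar N - μ) := Real.sqrt_pos.2 (by linarith)
  rw [alpha, nu, sqrt_muBar hN]
  linarith

theorem nu_sq_sub {N : ℕ} {μ : ℝ} (hN : 2 ≤ N) (hμ : μ < muBar N) :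
    nu N μ ^ 2 - ((N : ℝ) - 2) * nu N μ + μ = 0 := by
  have h1 : Real.sqrt (muBar N - μ) ^ 2 = muBar N - μ := Real.sq_sqrt (by linarith)
  rw [nu, sqrt_muBar hN]
  rw [muBar] at h1 ⊢
  linear_combination h1

end HardyEq

open HardyEq
theorem theoremt (N : ℕ) (hN : 3 ≤ N) (Ω : Opens (HardyEq.Euc N)) (h0 : (0 : HardyEq.Euc N) ∈ Ω)
    (μ p q : ℝ) (hμ0 : 0 < μ) (hμ : μ < HardyEq.muBar N)
    (hp : ((N : ℝ) + 2) / ((N : ℝ) - 2) ≤ p) (hpq : p < q)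
    (hq : q = (2 + HardyEq.nu N μ) / HardyEq.nu N μ)
    (u : HardyEq.Euc N → ℝ) (hu : HardyEq.IsSolution Ω μ p q u) (hrad : HardyEq.IsRadial Ω u) :
    ∃ v : HardyEq.Euc N → ℝ,
      v =ᵐ[volume.restrict (Ω : Set (HardyEq.Euc N))] u ∧
      (∀ᶠ x in 𝓝[≠] (0 : HardyEq.Euc N), ContinuousAt v x) ∧
      Tendsto
        (fun x => v x / (‖x‖ ^ (-HardyEq.nu N μ) * |Real.log ‖x‖| ^ (-(HardyEq.nu N μ / 2))))
        (𝓝[≠] (0 : HardyEq.Euc N))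
        (𝓝 ((HardyEq.alpha N μ * HardyEq.nu N μ / 2) ^ (HardyEq.nu N μ / 2))) := by
  have hN1 : 1 ≤ N := by omega
  have hN2 : 2 ≤ N := by omega
  have hNR : (3 : ℝ) ≤ N := by exact_mod_cast hN
  have hν := nu_pos hμ0 hμ
  have hα := alpha_pos hN2 hμ
  have hαdef : alpha N μ = N - 2 - 2 * nu N μ := rfl
  have hνeq := nu_sq_sub hN2 hμ
  set ν := nu N μ
  set α := alpha N μ
  have hνq : ν * q = 2 + ν := by rw [hq]; field_simp
  have hp0 : 0 < p := lt_of_lt_of_le (div_pos (by linarith) (by linarith)) hp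
  have hqm : 1 / (q - 1) = ν / 2 := by
    have h1 : q - 1 = 2 / ν := by
      field_simp
      linarith
    rw [h1, one_div_div]
  have hq1 : 1 < q := by
    by_contra! h
    nlinarith
  obtain ⟨R, hR, hΩ⟩ := Metric.isOpen_iff.1 Ω.isOpen 0 h0
  obtain ⟨f, hf⟩ := hrad
  -- Since `u > 0`, the radial representative may be replaced by `|f|`, which is nonnegative
  -- everywhere.
  have hf' : ∀ᵐ x ∂volume.restrict (Ω : Set (Euc N)), u x = |f ‖x‖| := by
    filter_upwards [hf, hu.1] with x hx hx'
    rw [← hx, abs_of_pos hx']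
  obtain ⟨w, w₁, hw, hint, hae⟩ := exists_emden_profile (f := fun r => |f r|) hN1 hα hαdef hνeq hνq
    hp0 hpq hR hΩ (fun r => abs_nonneg _) hf' hu
  have huw : ∀ᵐ x ∂volume.restrict (Ω : Set (Euc N)),
      x ≠ 0 → ‖x‖ < R → u x = ‖x‖ ^ (-ν) * w (‖x‖ ^ (-α)) := by
    filter_upwards [hf', ae_restrict_of_ae hae] with x hx hx' hx0 hxR
    rw [hx, hx' hx0 hxR]
  have hpos : ∃ s, R ^ (-α) < s ∧ 1 < s ∧ 0 < w s := by
    obtain ⟨s, hs, hws⟩ := exists_pos_of_ae_pos (ν := ν) (b := max (R ^ (-α)) 1) hα h0 hN1 hu.1 (by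
      filter_upwards [huw] with x hx hx0 hxb
      refine hx hx0 ?_
      have hx0' := norm_pos_iff.2 hx0
      by_contra! hle
      have h1 := Real.rpow_le_rpow_of_nonpos hR hle (by linarith : -α ≤ 0)
      exact absurd ((le_max_left _ _).trans_lt hxb) (not_lt.2 h1))
    exact ⟨s, (le_max_left _ _).trans_lt hs, (le_max_right _ _).trans_lt hs, hws⟩
  have hasymp := hw.tendsto_mul_log_rpow (by positivity) (by positivity)
    (div_pos (mul_pos hν (sub_pos.2 hpq)) hα) hp0 hpq hq1 hint hpos
  rw [hqm] at hasymp
  classical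
  set v : Euc N → ℝ := fun x =>
    if x ≠ 0 ∧ ‖x‖ < R then ‖x‖ ^ (-ν) * w (‖x‖ ^ (-α)) else u x with hvdef
  have hopen : ∀ᶠ x in 𝓝[≠] (0 : Euc N), x ≠ 0 ∧ ‖x‖ < R := by
    refine (eventually_mem_nhdsWithin).and (nhdsWithin_le_nhds ?_)
    filter_upwards [Metric.ball_mem_nhds (0 : Euc N) hR] with x hx
    simpa using hx
  refine ⟨v, ?_, ?_, ?_⟩
  · filter_upwards [huw] with x hx
    simp only [hvdef]
    split_ifs with h
    · exact (hx h.1 h.2).symm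
    · rfl
  · filter_upwards [hopen] with x hx
    have hx0 : 0 < ‖x‖ := norm_pos_iff.2 hx.1
    have h1 : ContinuousAt (fun x : Euc N => ‖x‖ ^ (-ν) * w (‖x‖ ^ (-α))) x := by
      have h2 : R ^ (-α) < ‖x‖ ^ (-α) := Real.rpow_lt_rpow_of_neg hx0 hx.2 (by linarith)
      have h3 : ∀ e : ℝ, ContinuousAt (fun x : Euc N => ‖x‖ ^ e) x := fun e =>
        continuous_norm.continuousAt.rpow_const (Or.inl hx0.ne')
      exact (h3 _).mul ((hw.hasDerivAt _ h2).continuousAt.comp (f := fun x : Euc N => ‖x‖ ^ (-α))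
        (h3 _))
    refine h1.congr ?_
    filter_upwards [isOpen_ne.mem_nhds hx.1,
      (isOpen_lt continuous_norm continuous_const).mem_nhds hx.2] with y hy1 hy2
    exact (if_pos ⟨hy1, hy2⟩).symm
  · have hlim := tendsto_of_tendsto_mul_log (v := v) hα hasymp (hopen.mono fun x hx => if_pos hx)
    -- The constants agree: `(ν / 2 / (1 / α ^ 2)) ^ (ν / 2) * α ^ (-(ν / 2)) = (α ν / 2) ^ (ν /
    -- 2)`.
    convert hlim using 2
    rw [Real.rpow_neg hα.le, ← div_eq_mul_inv, ← Real.div_rpow (by positivity) hα.le]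
    congr 1
    field_simp
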